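/- **Setting.** Let $X\in\mathbb R^{n\times k}$ have rows $X_1,\dots,X_n$ with $0\le X_u^\top X_v\le 1$ for all $u,v$ (including $u=v$). A random simple graph on $\{1,\dots,n\}$ with (symmetric, hollow, $0$-$1$) adjacency matrix $A$ is distributed as $\mathrm{RDPG}(X)$ if $\mathbb P[A]=\prod_{u>v}(X_u^\top X_v)^{A_{uv}}(1-X_u^\top X_v)^{1-A_{uv}}$. Put $P=XX^\top$ and $\delta(P)=\max_i\sum_{j}P_{ij}$. For a symmetric matrix $A$ with $|A|=(A^\top A)^{1/2}$, an adjacency spectral embedding of $A$ into $\mathbb R^d$ is $\mathrm{ASE}(A,d)=U_AS_A^{1/2}$, where $S_A$ is the diagonal matrix of the $d$ largest eigenvalues of $|A|$ in decreasing order and the columns of $U_A\in\mathbb R^{n\times d}$ are corresponding orthonormal eigenvectors. Write $\|M\|_{2\mapsto\infty}$ for the largest Euclidean norm of a row of $M$. **Theorem.** Fix $d\ge 1$ and let $A_n\sim\mathrm{RDPG}(X_n)$, $n\ge2$, with $X_n\in\mathbb R^{n\times d}$ and $P_n=X_nX_n^\top$. Assume: (i) $X_n$ has rank $d$ for all sufficiently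 large $n$; (ii) there is $a>0$ with $\delta(P_n)\ge\log^{4+a}n$ for all sufficiently large $n$; (iii) there is $c_0>0$ with $\lambda_d(P_n)/\delta(P_n)\ge c_0$ for all sufficiently large $n$, where $\lambda_d(P_n)$ is the $d$-th largest eigenvalue of $P_n$; (iv) there are $c_1,c_2>0$ and orthogonal $d\times d$ matrices $\widetilde W_n$ such that $\frac{c_1}{\sqrt n}\le|(U_{P_n}\widetilde W_n)_{ij}|\le\frac{c_2}{\sqrt n}$ for all $i,j$ and all sufficiently large $n$, where the columns of $U_{P_n}\in\mathbb R^{n\times d}$ are orthonormal eigenvectors of $P_n$ for its $d$ largest eigenvalues. Let $\mathcal C_n\subseteq\{1,\dots,n\}$, let $V_n\in\mathbb R^n$ have entries $(V_n)_i=\sqrt{1-\sum_{j=1}^d (X_n)_{ij}^2}$ for $i\in\mathcal C_n$ and $(V_n)_i=0$ otherwise, and let $A_n^{(c)}\sim\mathrm{RDPG}([X_n\mid V_n])$, where $A_n$ and $A_n^{(c)}$ are defined on a common probability space with an arbitrary joint distribution. Suppose $\alpha(n)=|\mathcal C_n|=o(\delta(P_n)^{3/4})$. Then there is a constant $K>0$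 such that, for all sufficiently large $n$, with probability at least $1-n^{-2}$ the following holds: for every choice $\widehat X_n^{(c)}$ of $\mathrm{ASE}(A_n^{(c)},d)$ and every choice $\widehat X_n$ of $\mathrm{ASE}(A_n,d)$ there exist orthogonal $W_{n,1},W_{n,2}\in\mathbb R^{d\times d}$ with $$\|\widehat X_n^{(c)}W_{n,1}-\widehat X_nW_{n,2}\|_{2\mapsto\infty}\le K\left(\frac{\log^2n}{\delta(P_n)^{1/2}}+\frac{\alpha(n)}{\delta(P_n)^{1/2}\sqrt n}+\frac{\alpha(n)^2}{\delta(P_n)^{3/2}}\right).$$ -/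

import Mathlib

open Filter MeasureTheory Asymptotics

namespace RDPG

noncomputable section

/-- The edge probability matrix `P = X Xᵀ` of a matrix of latent positions (one row per vertex). -/
def probMatrix {n : ℕ} {κ : Type*} [Fintype κ] (X : Matrix (Fin n) κ ℝ) :
    Matrix (Fin n) (Fin n) ℝ :=
  X * X.transpose

/-- Admissible latent positions: the inner product of any two rows (a row with itself included)
lies in `[0, 1]`. -/
def IsLatentPosition {n : ℕ} {κ : Type*} [Fintype κ] (X : Matrix (Fin n) κ ℝ) : Prop :=
  ∀ u v, 0 ≤ probMatrix X u v ∧ probMatrix X u v ≤ 1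

open Classical in
/-- The probability that the random dot product graph with latent positions `X` equals `G`:
the product over unordered pairs `u > v` of `P u v` for an edge and `1 - P u v` for a non-edge. -/
def graphProb {n : ℕ} {κ : Type*} [Fintype κ] (X : Matrix (Fin n) κ ℝ)
    (G : SimpleGraph (Fin n)) : ℝ :=
  ∏ u, ∏ v ∈ Finset.Iio u,
    if G.Adj u v then probMatrix X u v else 1 - probMatrix X u v

/-- The random graph `A`, defined on the probability space `(Ω, μ)`, is distributed as `RDPG(X)`. -/
structure IsRDPG {n : ℕ} {κ : Type*} [Fintype κ] {Ω : Type*} [MeasurableSpace Ω]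
    (μ : Measure Ω) (A : Ω → SimpleGraph (Fin n)) (X : Matrix (Fin n) κ ℝ) : Prop where
  latent : IsLatentPosition X
  measurableSet : ∀ G, MeasurableSet {ω | A ω = G}
  law : ∀ G, μ {ω | A ω = G} = ENNReal.ofReal (graphProb X G)

open Classical in
/-- The (symmetric, hollow, 0-1 valued) adjacency matrix of a graph. -/
def adj {n : ℕ} (G : SimpleGraph (Fin n)) : Matrix (Fin n) (Fin n) ℝ := G.adjMatrix ℝ

/-- The extra latent column that plants a pseudo-clique on the vertex set `C`. -/
def cliqueColumn {n d : ℕ} (X : Matrix (Fin n) (Fin d) ℝ) (C : Finset (Fin n)) : Fin n → ℝ :=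
  fun i => if i ∈ C then √(1 - ∑ j, X i j ^ 2) else 0

/-- The augmented latent positions `[X | V]`, where `V` is the pseudo-clique column. -/
def augment {n d : ℕ} (X : Matrix (Fin n) (Fin d) ℝ) (C : Finset (Fin n)) :
    Matrix (Fin n) (Fin d ⊕ Unit) ℝ :=
  Matrix.fromCols X (Matrix.replicateCol Unit (cliqueColumn X C))

/-- The maximal row sum `δ(P) = maxᵢ ∑ⱼ Pᵢⱼ`. -/
def maxDegree {n : ℕ} (P : Matrix (Fin n) (Fin n) ℝ) : ℝ := ⨆ i, ∑ j, P i j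

open Classical in
/-- The `k`-th largest eigenvalue (`1 ≤ k ≤ n`, with multiplicity) of a symmetric matrix. -/
def nthEigenvalue {n : ℕ} (M : Matrix (Fin n) (Fin n) ℝ) (k : ℕ) : ℝ :=
  if h : M.IsHermitian ∧ k - 1 < Fintype.card (Fin n) then h.1.eigenvalues₀ ⟨k - 1, h.2⟩ else 0

/-- `U` and `s` hold the `d` leading eigenvectors (as columns) and eigenvalues in some orthogonal
spectral decomposition of `M` with eigenvalues arranged in decreasing order. -/
def IsLeadingEigen {n d : ℕ} (M : Matrix (Fin n) (Fin n) ℝ)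
    (U : Matrix (Fin n) (Fin d) ℝ) (s : Fin d → ℝ) : Prop :=
  ∃ (h : d ≤ n) (V : Matrix (Fin n) (Fin n) ℝ) (t : Fin n → ℝ),
    V ∈ Matrix.orthogonalGroup (Fin n) ℝ ∧ Antitone t ∧
    M = V * Matrix.diagonal t * V.transpose ∧
    U = V.submatrix id (Fin.castLE h) ∧ s = t ∘ Fin.castLE h

/-- `B` is the absolute value `|A| = (Aᵀ A)^{1/2}`, the positive semidefinite square root. -/
def IsAbs {n : ℕ} (A B : Matrix (Fin n) (Fin n) ℝ) : Prop :=
  B.PosSemidef ∧ B * B = A.transpose * A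

/-- `Y = U S^{1/2}` is an adjacency spectral embedding of `A` into `ℝᵈ`: `S` holds the `d` largest
eigenvalues of `|A|` and `U` corresponding orthonormal eigenvectors. -/
def IsASE {n d : ℕ} (A : Matrix (Fin n) (Fin n) ℝ) (Y : Matrix (Fin n) (Fin d) ℝ) : Prop :=
  ∃ (B : Matrix (Fin n) (Fin n) ℝ) (U : Matrix (Fin n) (Fin d) ℝ) (s : Fin d → ℝ),
    IsAbs A B ∧ IsLeadingEigen B U s ∧ Y = U * Matrix.diagonal (fun j => √(s j))

/-- The `2 → ∞` norm: the largest Euclidean norm of a row. -/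
def twoToInfNorm {n d : ℕ} (M : Matrix (Fin n) (Fin d) ℝ) : ℝ := ⨆ i, √(∑ j, M i j ^ 2)

end

end RDPG

open RDPG

/-! Both embeddings are compared with one deterministic matrix. Write `P = XXᵀ = Q diag(p) Qᵀ`, of
rank `d`, with `δ` its maximal row sum. Each adjacency matrix is `P` plus centred noise, minus a
diagonal of norm at most 1, plus, for the augmented graph, the block `VVᵀ`. This block lives on `C ×
C` and has entries in [0, 1], so its norm is at most `α = |C|`. Once each embedding is close, up to
a rotation, to `P Q diag(p)^{-1/2}`, the triangle inequality finishes. Each graph enters through its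
own law and a union bound, so the coupling plays no role.

Row-wise closeness is a deterministic statement, `IsASE.exists_alignment`. The perturbation has norm
`ε` of order `√(δ log n) + α`, small against `λ_d ≥ c₀ δ`. Hence the leading eigenvectors `U` of
`|A|` are eigenvectors of `A` itself, and `U ≈ QW` with error of order `ε / δ`. The embedding equals
`A U S^{-1/2}`, so its row `i` sees only row `i` of `A`, of norm at most of order `√(δ log n)`.
Replacing `U S^{-1/2}` by `Q diag(p)^{-1/2} W` costs `√(δ log n) ε / δ^{3/2}`, at most of order `log
n / √δ + α² / δ^{3/2}`. What remains is `(A - P) Q`, with rows of order `log n + α / √n`, divided by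
`√δ`.

The random input is twofold: `prob_norm_noise_le` bounds the spectral norm of the noise by the trace
method, and `prob_row_noise_le`, a Chernoff bound, makes the entries of noise times `Q` of order
`log n`, because `Q` is delocalized. -/

namespace RDPG

noncomputable section

/-! ### Random graphs with independent edges, as finite sums. -/

open Classical in
/-- The unordered pairs of vertices, represented with the larger vertex first. -/
def vertexPairs (n : ℕ) : Finset (Fin n × Fin n) := Finset.univ.filter fun e => e.2 < e.1

lemma mem_vertexPairs {n : ℕ} {e : Fin n × Fin n} : e ∈ vertexPairs n ↔ e.2 < e.1 := by
  simp [vertexPairs]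

-- Expanding the product of sums gives one term per set of pairs, and such sets are exactly the
-- graphs. This identity encodes the independence of the edges.
open Classical in
lemma sum_simpleGraph_prod {n : ℕ} (f g : Fin n × Fin n → ℝ) :
    ∑ G : SimpleGraph (Fin n), ∏ e ∈ vertexPairs n, (if G.Adj e.1 e.2 then f e else g e)
      = ∏ e ∈ vertexPairs n, (f e + g e) := by
  rw [Finset.prod_add]
  refine Finset.sum_bij' (fun G _ => (vertexPairs n).filter fun e => G.Adj e.1 e.2)
    (fun t _ => SimpleGraph.fromRel fun u v => (u, v) ∈ t) ?_ ?_ ?_ ?_ ?_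
  · intro G _
    simp
  · simp
  · intro G _
    ext u v
    simp only [SimpleGraph.fromRel_adj, Finset.mem_filter, mem_vertexPairs]
    constructor
    · rintro ⟨-, h | h⟩
      · exact h.2
      · exact h.2.symm
    · intro h
      refine ⟨h.ne, ?_⟩
      rcases lt_or_gt_of_ne h.ne with h' | h'
      · exact Or.inr ⟨h', h.symm⟩
      · exact Or.inl ⟨h', h⟩
  · intro t ht
    rw [Finset.mem_powerset] at ht
    ext ⟨u, v⟩
    simp only [SimpleGraph.fromRel_adj, Finset.mem_filter, mem_vertexPairs]
    constructor
    · rintro ⟨huv, -, h | h⟩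
      · exact h
      · exact absurd (mem_vertexPairs.1 (ht h)) (not_lt.2 huv.le)
    · intro h
      have := mem_vertexPairs.1 (ht h)
      exact ⟨this, ne_of_gt this, Or.inl h⟩
  · intro G _
    rw [Finset.prod_ite]
    congr 1
    refine Finset.prod_congr ?_ fun _ _ => rfl
    ext e
    simp only [Finset.mem_filter, Finset.mem_sdiff]
    tauto

open Classical in
/-- The probability of a graph whose edges are independent with probabilities `P u v`. -/
def edgeWeight {n : ℕ} (P : Matrix (Fin n) (Fin n) ℝ) (G : SimpleGraph (Fin n)) : ℝ :=
  ∏ e ∈ vertexPairs n, if G.Adj e.1 e.2 then P e.1 e.2 else 1 - P e.1 e.2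

lemma graphProb_eq_edgeWeight {n : ℕ} {κ : Type*} [Fintype κ] (X : Matrix (Fin n) κ ℝ)
    (G : SimpleGraph (Fin n)) : graphProb X G = edgeWeight (probMatrix X) G := by
  classical
  unfold graphProb edgeWeight
  rw [Finset.prod_sigma']
  refine Finset.prod_bij' (fun e _ => (e.1, e.2)) (fun e _ => ⟨e.1, e.2⟩) ?_ ?_ ?_ ?_ ?_ <;>
    simp [mem_vertexPairs]

/-- Matrices of edge probabilities of an undirected random graph. -/
structure IsEdgeProb {n : ℕ} (P : Matrix (Fin n) (Fin n) ℝ) : Prop where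
  symm : ∀ u v, P u v = P v u
  nonneg : ∀ u v, 0 ≤ P u v
  le_one : ∀ u v, P u v ≤ 1

lemma IsLatentPosition.isEdgeProb {n : ℕ} {κ : Type*} [Fintype κ] {X : Matrix (Fin n) κ ℝ}
    (h : IsLatentPosition X) : IsEdgeProb (probMatrix X) where
  symm u v := by simp [probMatrix, Matrix.mul_apply, mul_comm]
  nonneg u v := (h u v).1
  le_one u v := (h u v).2

lemma edgeWeight_nonneg {n : ℕ} {P : Matrix (Fin n) (Fin n) ℝ} (hP : IsEdgeProb P)
    (G : SimpleGraph (Fin n)) : 0 ≤ edgeWeight P G := by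
  classical
  refine Finset.prod_nonneg fun e _ => ?_
  split_ifs
  · exact hP.nonneg _ _
  · linarith [hP.le_one e.1 e.2]

open Classical in
/-- Expectation of a function of a graph with independent edges. -/
def expect {n : ℕ} (P : Matrix (Fin n) (Fin n) ℝ) (f : SimpleGraph (Fin n) → ℝ) : ℝ :=
  ∑ G, edgeWeight P G * f G

lemma expect_sum {n : ℕ} (P : Matrix (Fin n) (Fin n) ℝ) {ι : Type*} (s : Finset ι)
    (f : ι → SimpleGraph (Fin n) → ℝ) :
    expect P (fun G => ∑ i ∈ s, f i G) = ∑ i ∈ s, expect P (f i) := by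
  simp only [expect, Finset.mul_sum]
  exact Finset.sum_comm

lemma adj_apply_of_adj {n : ℕ} {G : SimpleGraph (Fin n)} {u v : Fin n} (h : G.Adj u v) :
    adj G u v = 1 := by simp [adj, h]

lemma adj_apply_of_not_adj {n : ℕ} {G : SimpleGraph (Fin n)} {u v : Fin n} (h : ¬ G.Adj u v) :
    adj G u v = 0 := by simp [adj, h]

/-- The expectation of a product over the independent edges. -/
lemma expect_prod {n : ℕ} (P : Matrix (Fin n) (Fin n) ℝ) (φ : Fin n × Fin n → ℝ → ℝ) :
    expect P (fun G => ∏ e ∈ vertexPairs n, φ e (adj G e.1 e.2))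
      = ∏ e ∈ vertexPairs n, (P e.1 e.2 * φ e 1 + (1 - P e.1 e.2) * φ e 0) := by
  classical
  rw [← sum_simpleGraph_prod]
  refine Finset.sum_congr rfl fun G _ => ?_
  rw [edgeWeight, ← Finset.prod_mul_distrib]
  refine Finset.prod_congr rfl fun e _ => ?_
  split_ifs with h
  · rw [adj_apply_of_adj h]
  · rw [adj_apply_of_not_adj h]

open Classical in
/-- The probability of an event of a graph with independent edges. -/
def prob {n : ℕ} (P : Matrix (Fin n) (Fin n) ℝ) (s : SimpleGraph (Fin n) → Prop) : ℝ :=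
  ∑ G with s G, edgeWeight P G

/-- Markov's inequality. -/
lemma prob_le_expect_div {n : ℕ} {P : Matrix (Fin n) (Fin n) ℝ} (hP : IsEdgeProb P)
    {f : SimpleGraph (Fin n) → ℝ} (hf : ∀ G, 0 ≤ f G) {c : ℝ} (hc : 0 < c)
    {s : SimpleGraph (Fin n) → Prop} (hs : ∀ G, s G → c ≤ f G) :
    prob P s ≤ expect P f / c := by
  classical
  rw [prob, le_div_iff₀ hc, Finset.sum_mul, expect]
  refine (Finset.sum_le_sum fun G hG => ?_).trans
    (Finset.sum_le_sum_of_subset_of_nonneg (Finset.subset_univ (Finset.univ.filter fun G => s G))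
      fun G _ _ => mul_nonneg (edgeWeight_nonneg hP G) (hf G))
  exact mul_le_mul_of_nonneg_left (hs G (Finset.mem_filter.1 hG).2) (edgeWeight_nonneg hP G)

/-- The centered adjacency matrix. -/
def noise {n : ℕ} (P : Matrix (Fin n) (Fin n) ℝ) (G : SimpleGraph (Fin n)) :
    Matrix (Fin n) (Fin n) ℝ :=
  adj G - P + Matrix.diagonal fun i => P i i

lemma adj_symm {n : ℕ} (G : SimpleGraph (Fin n)) (u v : Fin n) : adj G u v = adj G v u := by
  by_cases h : G.Adj u v
  · rw [adj_apply_of_adj h, adj_apply_of_adj h.symm]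
  · rw [adj_apply_of_not_adj h, adj_apply_of_not_adj fun h' => h h'.symm]

lemma adj_self {n : ℕ} (G : SimpleGraph (Fin n)) (u : Fin n) : adj G u u = 0 := by
  simp [adj]

lemma noise_self {n : ℕ} (P : Matrix (Fin n) (Fin n) ℝ) (G : SimpleGraph (Fin n)) (u : Fin n) :
    noise P G u u = 0 := by
  simp [noise, adj_self]

lemma noise_of_ne {n : ℕ} (P : Matrix (Fin n) (Fin n) ℝ) (G : SimpleGraph (Fin n)) {u v : Fin n}
    (h : u ≠ v) : noise P G u v = adj G u v - P u v := by
  simp [noise, h]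

lemma noise_symm {n : ℕ} {P : Matrix (Fin n) (Fin n) ℝ} (hP : IsEdgeProb P)
    (G : SimpleGraph (Fin n)) (u v : Fin n) : noise P G u v = noise P G v u := by
  rcases eq_or_ne u v with rfl | h
  · rfl
  · rw [noise_of_ne _ _ h, noise_of_ne _ _ h.symm, adj_symm, hP.symm]

/-- The unordered pair `{u, v}`, with the larger vertex first. -/
def orderedPair {n : ℕ} (u v : Fin n) : Fin n × Fin n := (max u v, min u v)

lemma orderedPair_injective {n : ℕ} (u : Fin n) : Function.Injective (orderedPair u) := by
  intro v w h
  simp only [orderedPair, Prod.mk.injEq] at h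
  obtain ⟨h₁, h₂⟩ := h
  rcases le_total u v with h | h <;> rcases le_total u w with h' | h' <;>
    simp_all <;> order

lemma noise_orderedPair {n : ℕ} {P : Matrix (Fin n) (Fin n) ℝ} (hP : IsEdgeProb P)
    (G : SimpleGraph (Fin n)) (u v : Fin n) :
    noise P G (orderedPair u v).1 (orderedPair u v).2 = noise P G u v := by
  rcases le_total u v with h | h
  · simp [orderedPair, h, noise_symm hP G v u]
  · simp [orderedPair, h]

lemma prob_orderedPair {n : ℕ} {P : Matrix (Fin n) (Fin n) ℝ} (hP : IsEdgeProb P)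
    (u v : Fin n) : P (orderedPair u v).1 (orderedPair u v).2 = P u v := by
  rcases le_total u v with h | h
  · simp [orderedPair, h, hP.symm v u]
  · simp [orderedPair, h]

/-! ### Trace method: moments of the noise along walks. -/

lemma abs_bernoulli_moment_le {p : ℝ} (h₀ : 0 ≤ p) (h₁ : p ≤ 1) {c : ℕ} (hc : 2 ≤ c) :
    |p * (1 - p) ^ c + (1 - p) * (0 - p) ^ c| ≤ p := by
  have hq : 0 ≤ 1 - p := by linarith
  have e₁ : (1 - p) ^ c ≤ 1 - p := by
    simpa using pow_le_pow_of_le_one hq (by linarith) (show 1 ≤ c by omega)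
  have e₂ : p ^ c ≤ p ^ 2 := pow_le_pow_of_le_one h₀ h₁ hc
  have e₃ : |(0 - p) ^ c| = p ^ c := by rw [abs_pow, zero_sub, abs_neg, abs_of_nonneg h₀]
  have e₄ : |(1 - p) ^ c| = (1 - p) ^ c := abs_of_nonneg (by positivity)
  calc _ ≤ |p * (1 - p) ^ c| + |(1 - p) * (0 - p) ^ c| := abs_add_le _ _
    _ = p * (1 - p) ^ c + (1 - p) * p ^ c := by
      rw [abs_mul, abs_mul, e₃, e₄, abs_of_nonneg h₀, abs_of_nonneg hq]
    _ ≤ p * (1 - p) + (1 - p) * p ^ 2 := by gcongr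
    _ ≤ p := by nlinarith [mul_nonneg h₀ hq, mul_nonneg h₀ (sq_nonneg p)]

/-- The weight of a list of edges: a first visit of an edge `e` costs `P e / β`, and each further
visit costs `β`. -/
def walkWeight {n : ℕ} (P : Matrix (Fin n) (Fin n) ℝ) (β : ℝ) (l : List (Fin n × Fin n)) : ℝ :=
  (∏ e ∈ l.toFinset, P e.1 e.2) * (β ^ l.length / β ^ (2 * l.toFinset.card))

lemma walkWeight_nonneg {n : ℕ} {P : Matrix (Fin n) (Fin n) ℝ} (hP : IsEdgeProb P) {β : ℝ}
    (hβ : 0 ≤ β) (l : List (Fin n × Fin n)) : 0 ≤ walkWeight P β l :=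
  mul_nonneg (Finset.prod_nonneg fun _ _ => hP.nonneg _ _) (by positivity)

lemma walkWeight_cons_of_mem {n : ℕ} (P : Matrix (Fin n) (Fin n) ℝ) (β : ℝ)
    {l : List (Fin n × Fin n)} {e : Fin n × Fin n} (h : e ∈ l) :
    walkWeight P β (e :: l) = walkWeight P β l * β := by
  have : (e :: l).toFinset = l.toFinset := by
    rw [List.toFinset_cons, Finset.insert_eq_self]; simpa
  rw [walkWeight, walkWeight, this, List.length_cons, pow_succ]
  ring

lemma walkWeight_cons_of_notMem {n : ℕ} (P : Matrix (Fin n) (Fin n) ℝ) {β : ℝ} (hβ : β ≠ 0)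
    {l : List (Fin n × Fin n)} {e : Fin n × Fin n} (h : e ∉ l) :
    walkWeight P β (e :: l) = walkWeight P β l * (P e.1 e.2 / β) := by
  have h' : e ∉ l.toFinset := by simpa
  rw [walkWeight, walkWeight, List.toFinset_cons, Finset.prod_insert h',
    Finset.card_insert_of_notMem h', List.length_cons, pow_succ, mul_add, pow_add]
  field_simp

/-- A loop makes the product vanish, and an edge visited exactly once makes the expectation vanish
by independence. Otherwise every distinct edge is visited at least twice and contributes at most `P
e`; the length is then at least twice the number of distinct edges, so the power of `β ≥ 1` only
helps. -/
lemma expect_prod_noise_le {n : ℕ} {P : Matrix (Fin n) (Fin n) ℝ} (hP : IsEdgeProb P) {β : ℝ}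
    (hβ : 1 ≤ β) (l : List (Fin n × Fin n)) (hl : ∀ e ∈ l, e.2 ≤ e.1) :
    expect P (fun G => (l.map fun e => noise P G e.1 e.2).prod) ≤ walkWeight P β l := by
  classical
  have hw := walkWeight_nonneg hP (zero_le_one.trans hβ) l
  by_cases hloop : ∃ e ∈ l, e.1 = e.2
  · obtain ⟨e, he, hee⟩ := hloop
    have : ∀ G, (l.map fun e => noise P G e.1 e.2).prod = 0 := fun G =>
      List.prod_eq_zero (List.mem_map.2 ⟨e, he, by rw [hee, noise_self]⟩)
    simpa [expect, this] using hw
  push Not at hloop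
  have hsub : l.toFinset ⊆ vertexPairs n := fun e he => by
    rw [List.mem_toFinset] at he
    exact mem_vertexPairs.2 (lt_of_le_of_ne (hl e he) (hloop e he).symm)
  let c : Fin n × Fin n → ℕ := fun e => Multiset.count e (l : Multiset (Fin n × Fin n))
  have hzero : ∀ e ∉ l.toFinset, c e = 0 := fun e he =>
    Multiset.count_eq_zero.2 (by simpa using he)
  have hprod : ∀ G, (l.map fun e => noise P G e.1 e.2).prod
      = ∏ e ∈ vertexPairs n, (adj G e.1 e.2 - P e.1 e.2) ^ c e := fun G => by
    refine (Finset.prod_multiset_map_count (l : Multiset (Fin n × Fin n)) _).trans ?_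
    refine (Finset.prod_congr rfl fun e he => ?_).trans
      (Finset.prod_subset hsub fun e _ he => ?_)
    · rw [noise_of_ne P G (ne_of_gt (mem_vertexPairs.1 (hsub he)))]
    · rw [hzero e he, pow_zero]
  simp only [hprod]
  rw [expect_prod P fun e a => (a - P e.1 e.2) ^ c e,
    ← Finset.prod_subset hsub fun e _ he => by
      rw [hzero e he]; ring]
  by_cases hone : ∃ e ∈ l, c e = 1
  · obtain ⟨e, he, hc⟩ := hone
    rw [Finset.prod_eq_zero (List.mem_toFinset.2 he) (by rw [hc]; ring)]
    exact hw
  have htwo : ∀ e ∈ l.toFinset, 2 ≤ c e := fun e he => by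
    rw [List.mem_toFinset] at he
    have h₁ : 0 < c e := Multiset.count_pos.2 (Multiset.mem_coe.2 he)
    have h₂ : c e ≠ 1 := fun h => hone ⟨e, he, h⟩
    omega
  have hcard : 2 * l.toFinset.card ≤ l.length := by
    have h := Multiset.toFinset_sum_count_eq (l : Multiset (Fin n × Fin n))
    rw [Multiset.coe_card] at h
    rw [← h, mul_comm]
    exact Finset.card_nsmul_le_sum _ _ _ htwo
  refine (le_abs_self _).trans ?_
  rw [Finset.abs_prod, walkWeight]
  have h₁ : ∏ e ∈ l.toFinset, |P e.1 e.2 * (1 - P e.1 e.2) ^ c e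
      + (1 - P e.1 e.2) * (0 - P e.1 e.2) ^ c e| ≤ ∏ e ∈ l.toFinset, P e.1 e.2 :=
    Finset.prod_le_prod (fun _ _ => abs_nonneg _) fun e he =>
      abs_bernoulli_moment_le (hP.nonneg _ _) (hP.le_one _ _) (htwo e he)
  refine h₁.trans (le_mul_of_one_le_right (Finset.prod_nonneg fun _ _ => hP.nonneg _ _) ?_)
  rw [one_le_div (by positivity)]
  exact pow_le_pow_right₀ hβ hcard

/-- The total weight of the walks of length `m` from `u` that continue a walk with edges `l`. -/
def walkSum {n : ℕ} (P : Matrix (Fin n) (Fin n) ℝ) (β : ℝ) :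
    ℕ → Fin n → List (Fin n × Fin n) → ℝ
  | 0, _, l => walkWeight P β l
  | m + 1, u, l => ∑ v, walkSum P β m v (orderedPair u v :: l)

/-- The matrix power is expanded one step at a time; `l` records the edges already walked, which is
why the induction must run over arbitrary `l`. -/
lemma expect_noise_pow_le {n : ℕ} {P : Matrix (Fin n) (Fin n) ℝ} (hP : IsEdgeProb P) {β : ℝ}
    (hβ : 1 ≤ β) (m : ℕ) (u v : Fin n) (l : List (Fin n × Fin n)) (hl : ∀ e ∈ l, e.2 ≤ e.1) :
    expect P (fun G => (l.map fun e => noise P G e.1 e.2).prod * (noise P G ^ m) u v)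
      ≤ walkSum P β m u l := by
  induction m generalizing u l with
  | zero =>
    rcases eq_or_ne u v with rfl | h
    · simpa [walkSum] using expect_prod_noise_le hP hβ l hl
    · simpa [walkSum, Matrix.one_apply_ne h, expect] using
        walkWeight_nonneg hP (zero_le_one.trans hβ) l
  | succ m ih =>
    have : (fun G => (l.map fun e => noise P G e.1 e.2).prod * (noise P G ^ (m + 1)) u v)
        = fun G => ∑ w, ((orderedPair u w :: l).map fun e => noise P G e.1 e.2).prod
          * (noise P G ^ m) w v := by
      funext G
      rw [pow_succ', Matrix.mul_apply, Finset.mul_sum]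
      refine Finset.sum_congr rfl fun w _ => ?_
      rw [List.map_cons, List.prod_cons, noise_orderedPair hP]
      ring
    rw [this, expect_sum, walkSum]
    refine Finset.sum_le_sum fun w _ => ih w _ fun e he => ?_
    rcases List.mem_cons.1 he with rfl | he
    · exact min_le_max
    · exact hl e he

/-- The next edge is either old or new. At most `N` choices of `v` reuse an edge of `l`, since `v`
is determined by the pair, and each costs `β`; new edges cost `P u v / β`, in total at most `Δ / β`.
This replaces the combinatorial classification of walks. -/
lemma sum_walkWeight_cons_le {n : ℕ} {P : Matrix (Fin n) (Fin n) ℝ} (hP : IsEdgeProb P)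
    {β Δ b : ℝ} {N : ℕ} (hβ : 1 ≤ β) (hΔ : ∀ u, ∑ v, P u v ≤ Δ) (hNb : N * β ≤ b)
    (hΔb : Δ / β ≤ b) (u : Fin n) (l : List (Fin n × Fin n)) (hl : l.length ≤ N) :
    ∑ v, walkWeight P β (orderedPair u v :: l) ≤ walkWeight P β l * (2 * b) := by
  classical
  have hβ₀ : 0 < β := zero_lt_one.trans_le hβ
  have hw := walkWeight_nonneg hP hβ₀.le l
  have hpt : ∀ v, walkWeight P β (orderedPair u v :: l)
      ≤ walkWeight P β l * ((if orderedPair u v ∈ l then β else 0) + P u v / β) := fun v => by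
    have hp : 0 ≤ P u v / β := div_nonneg (hP.nonneg _ _) hβ₀.le
    split_ifs with h
    · rw [walkWeight_cons_of_mem P β h]
      exact mul_le_mul_of_nonneg_left (by linarith) hw
    · rw [walkWeight_cons_of_notMem P hβ₀.ne' h, prob_orderedPair hP, zero_add]
  have hcard : ((Finset.univ.filter fun v => orderedPair u v ∈ l).card : ℝ) ≤ N := by
    have : (Finset.univ.filter fun v => orderedPair u v ∈ l).card ≤ l.toFinset.card :=
      Finset.card_le_card_of_injOn (orderedPair u) (fun v hv => by simpa using hv)
        (orderedPair_injective u).injOn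
    exact_mod_cast this.trans ((List.toFinset_card_le l).trans hl)
  calc _ ≤ ∑ v, walkWeight P β l * ((if orderedPair u v ∈ l then β else 0) + P u v / β) :=
        Finset.sum_le_sum fun v _ => hpt v
    _ = walkWeight P β l * ((Finset.univ.filter fun v => orderedPair u v ∈ l).card * β
          + (∑ v, P u v) / β) := by
      rw [← Finset.mul_sum, Finset.sum_add_distrib, ← Finset.sum_filter, Finset.sum_const,
        nsmul_eq_mul, Finset.sum_div]
    _ ≤ walkWeight P β l * (2 * b) := by
      refine mul_le_mul_of_nonneg_left ?_ hw
      have h₁ := mul_le_mul_of_nonneg_right hcard hβ₀.le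
      have h₂ := div_le_div_of_nonneg_right (hΔ u) hβ₀.le
      linarith

lemma walkSum_le {n : ℕ} {P : Matrix (Fin n) (Fin n) ℝ} (hP : IsEdgeProb P)
    {β Δ b : ℝ} {N : ℕ} (hβ : 1 ≤ β) (hΔ : ∀ u, ∑ v, P u v ≤ Δ) (hNb : N * β ≤ b)
    (hΔb : Δ / β ≤ b) (m : ℕ) (u : Fin n) (l : List (Fin n × Fin n)) (hl : l.length + m ≤ N) :
    walkSum P β m u l ≤ walkWeight P β l * (2 * b) ^ m := by
  induction m generalizing u l with
  | zero => simp [walkSum]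
  | succ m ih =>
    have hb : 0 ≤ b := le_trans (by positivity) hNb
    rw [walkSum]
    calc _ ≤ ∑ v, walkWeight P β (orderedPair u v :: l) * (2 * b) ^ m :=
          Finset.sum_le_sum fun v _ => ih v _ (by rw [List.length_cons]; omega)
      _ ≤ walkWeight P β l * (2 * b) * (2 * b) ^ m := by
        rw [← Finset.sum_mul]
        exact mul_le_mul_of_nonneg_right
          (sum_walkWeight_cons_le hP hβ hΔ hNb hΔb u l (by omega)) (by positivity)
      _ = _ := by ring

lemma expect_trace_noise_pow_le {n : ℕ} {P : Matrix (Fin n) (Fin n) ℝ} (hP : IsEdgeProb P)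
    {Δ : ℝ} {N : ℕ} (hN : 1 ≤ N) (hNΔ : N ≤ Δ) (hΔ : ∀ u, ∑ v, P u v ≤ Δ) :
    expect P (fun G => (noise P G ^ N).trace) ≤ n * (2 * √(N * Δ)) ^ N := by
  have hN₀ : (0 : ℝ) < N := by exact_mod_cast hN
  have hΔ₀ : 0 < Δ := hN₀.trans_le hNΔ
  -- The choice `β = √(Δ / N)` balances `N β` and `Δ / β`: both equal `√(N Δ)`. The assumption `N ≤
  -- Δ` is what gives `β ≥ 1`.
  have hβ : 1 ≤ √Δ / √N := by
    rw [one_le_div (Real.sqrt_pos.2 hN₀)]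
    exact Real.sqrt_le_sqrt hNΔ
  have h₁ : N * (√Δ / √N) ≤ √(N * Δ) := by
    rw [Real.sqrt_mul hN₀.le]
    apply le_of_eq
    have := Real.mul_self_sqrt hN₀.le
    have h' := (Real.sqrt_pos.2 hN₀).ne'
    field_simp
    linear_combination (-1) * this
  have h₂ : Δ / (√Δ / √N) ≤ √(N * Δ) := by
    rw [Real.sqrt_mul hN₀.le]
    apply le_of_eq
    have := Real.mul_self_sqrt hΔ₀.le
    have h' := (Real.sqrt_pos.2 hN₀).ne'
    have h'' := (Real.sqrt_pos.2 hΔ₀).ne'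
    field_simp
    linear_combination (-1) * this
  simp only [Matrix.trace, Matrix.diag]
  rw [expect_sum]
  calc _ ≤ ∑ _u : Fin n, (2 * √(N * Δ)) ^ N := Finset.sum_le_sum fun u _ => by
        have := (expect_noise_pow_le hP hβ N u u [] (by simp)).trans
          (walkSum_le hP hβ hΔ h₁ h₂ N u [] (by simp))
        simpa [walkWeight] using this
    _ = _ := by simp

/-! ### Row norms, and the spectral norm of the noise. -/

open scoped Matrix.Norms.L2Operator

/-- The Euclidean norm of a row. -/
def rowNorm {n d : ℕ} (M : Matrix (Fin n) (Fin d) ℝ) (i : Fin n) : ℝ := √(∑ j, M i j ^ 2)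

lemma rowNorm_eq_norm {n d : ℕ} (M : Matrix (Fin n) (Fin d) ℝ) (i : Fin n) :
    rowNorm M i = ‖WithLp.toLp 2 (M i)‖ := by
  simp [rowNorm, EuclideanSpace.norm_eq]

lemma rowNorm_nonneg {n d : ℕ} (M : Matrix (Fin n) (Fin d) ℝ) (i : Fin n) : 0 ≤ rowNorm M i :=
  Real.sqrt_nonneg _

lemma rowNorm_add_le {n d : ℕ} (M N : Matrix (Fin n) (Fin d) ℝ) (i : Fin n) :
    rowNorm (M + N) i ≤ rowNorm M i + rowNorm N i := by
  simp only [rowNorm_eq_norm]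
  exact norm_add_le (WithLp.toLp 2 (M i)) (WithLp.toLp 2 (N i))

lemma rowNorm_neg {n d : ℕ} (M : Matrix (Fin n) (Fin d) ℝ) (i : Fin n) :
    rowNorm (-M) i = rowNorm M i := by
  simp [rowNorm]

lemma rowNorm_sub_le {n d : ℕ} (M N : Matrix (Fin n) (Fin d) ℝ) (i : Fin n) :
    rowNorm (M - N) i ≤ rowNorm M i + rowNorm N i := by
  rw [sub_eq_add_neg, ← rowNorm_neg N]
  exact rowNorm_add_le _ _ _

lemma l2_opNorm_transpose {m n : ℕ} (B : Matrix (Fin m) (Fin n) ℝ) : ‖B.transpose‖ = ‖B‖ := by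
  rw [← Matrix.l2_opNorm_conjTranspose B, Matrix.conjTranspose_eq_transpose_of_trivial]

lemma rowNorm_mul_le {n m d : ℕ} (A : Matrix (Fin n) (Fin m) ℝ) (B : Matrix (Fin m) (Fin d) ℝ)
    (i : Fin n) : rowNorm (A * B) i ≤ rowNorm A i * ‖B‖ := by
  rw [rowNorm_eq_norm, rowNorm_eq_norm, mul_comm, ← l2_opNorm_transpose]
  have := Matrix.l2_opNorm_mulVec B.transpose (WithLp.toLp 2 (A i))
  convert this using 3
  rw [Matrix.mulVec_transpose]
  rfl

lemma rowNorm_one {n : ℕ} (i : Fin n) : rowNorm (1 : Matrix (Fin n) (Fin n) ℝ) i = 1 := by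
  simp [rowNorm, Matrix.one_apply]

lemma rowNorm_le_norm {n d : ℕ} (M : Matrix (Fin n) (Fin d) ℝ) (i : Fin n) :
    rowNorm M i ≤ ‖M‖ := by
  simpa [rowNorm_one] using rowNorm_mul_le 1 M i

lemma l2_opNorm_le_of_mulVec {m n : ℕ} (M : Matrix (Fin m) (Fin n) ℝ) {c : ℝ} (hc : 0 ≤ c)
    (h : ∀ x : Fin n → ℝ, ∑ i, (M.mulVec x) i ^ 2 ≤ c ^ 2 * ∑ j, x j ^ 2) : ‖M‖ ≤ c := by
  rw [Matrix.l2_opNorm_def]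
  refine ContinuousLinearMap.opNorm_le_bound _ hc fun x => ?_
  rw [EuclideanSpace.norm_eq, EuclideanSpace.norm_eq]
  refine Real.sqrt_le_iff.2 ⟨by positivity, ?_⟩
  rw [mul_pow, Real.sq_sqrt (by positivity)]
  simpa using h x

lemma l2_opNorm_le_frobenius {m n : ℕ} (M : Matrix (Fin m) (Fin n) ℝ) :
    ‖M‖ ≤ √(∑ i, ∑ j, M i j ^ 2) := by
  refine l2_opNorm_le_of_mulVec M (Real.sqrt_nonneg _) fun x => ?_
  rw [Real.sq_sqrt (by positivity), Finset.sum_mul]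
  refine Finset.sum_le_sum fun i _ => ?_
  rw [Matrix.mulVec, dotProduct]
  exact Finset.sum_mul_sq_le_sq_mul_sq _ _ _

lemma abs_entry_le_norm {m n : ℕ} (M : Matrix (Fin m) (Fin n) ℝ) (i : Fin m) (j : Fin n) :
    |M i j| ≤ ‖M‖ := by
  refine le_trans ?_ (rowNorm_le_norm M i)
  refine Real.le_sqrt_of_sq_le ?_
  rw [sq_abs]
  exact Finset.single_le_sum (f := fun j => M i j ^ 2) (fun _ _ => sq_nonneg _) (Finset.mem_univ j)

/-- Norms of self-adjoint matrices commute with repeated squaring, hence the powers of two. The norm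
of `H ^ 2 ^ m` is at most its Frobenius norm, whose square is the trace of the next power. -/
lemma norm_pow_le_trace {n : ℕ} {H : Matrix (Fin n) (Fin n) ℝ} (hH : H.transpose = H) (m : ℕ) :
    ‖H‖ ^ 2 ^ (m + 1) ≤ (H ^ 2 ^ (m + 1)).trace := by
  have hsa : IsSelfAdjoint H := by
    rw [IsSelfAdjoint, Matrix.star_eq_conjTranspose, Matrix.conjTranspose_eq_transpose_of_trivial,
      hH]
  have h₁ : ‖H ^ 2 ^ m‖ = ‖H‖ ^ 2 ^ m := by
    have := hsa.nnnorm_pow_two_pow m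
    simpa using congrArg NNReal.toReal this
  have hT : (H ^ 2 ^ m).transpose = H ^ 2 ^ m := by rw [Matrix.transpose_pow, hH]
  have h₂ : (H ^ 2 ^ (m + 1)).trace = ∑ i, ∑ j, (H ^ 2 ^ m) i j ^ 2 := by
    rw [pow_succ 2 m, pow_mul, pow_two (H ^ 2 ^ m), Matrix.trace]
    refine Finset.sum_congr rfl fun i _ => ?_
    rw [Matrix.diag_apply, Matrix.mul_apply]
    refine Finset.sum_congr rfl fun j _ => ?_
    rw [sq, ← congrFun (congrFun hT j) i, Matrix.transpose_apply]
  rw [pow_succ 2 m, pow_mul, ← h₁, ← pow_succ 2 m, h₂,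
    ← Real.sq_sqrt (show 0 ≤ ∑ i, ∑ j, (H ^ 2 ^ m) i j ^ 2 by positivity)]
  gcongr
  exact l2_opNorm_le_frobenius _

lemma noise_transpose {n : ℕ} {P : Matrix (Fin n) (Fin n) ℝ} (hP : IsEdgeProb P)
    (G : SimpleGraph (Fin n)) : (noise P G).transpose = noise P G := by
  ext u v
  exact noise_symm hP G v u

/-- The spectral norm of the noise exceeds `√(Δ log n)` with polynomially small probability. -/
lemma prob_norm_noise_le {n : ℕ} {P : Matrix (Fin n) (Fin n) ℝ} (hP : IsEdgeProb P) {Δ : ℝ}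
    (hlog : 1 ≤ Real.log n) (hΔlog : 4 * Real.log n ≤ Δ) (hΔ : ∀ u, ∑ v, P u v ≤ Δ) :
    prob P (fun G => ¬ ‖noise P G‖ ≤ 32 * √(Δ * Real.log n)) ≤ 1 / (n : ℝ) ^ 3 := by
  -- The exponent `N = 4 * 2 ^ j` is a power of two between `2 log n` and `4 log n`. The constant 32
  -- then makes `2√(NΔ)` at most `t / 8`, and `8 ^ (-N) ≤ exp(-2N) ≤ n ^ (-4)` absorbs the factor
  -- `n` of the trace.
  obtain ⟨j, hj₁, hj₂⟩ := exists_nat_pow_near hlog (one_lt_two : (1 : ℝ) < 2)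
  have hn : (0 : ℝ) < n := by
    rcases Nat.eq_zero_or_pos n with rfl | h
    · norm_num at hlog
    · exact_mod_cast h
  set x := Real.log n with hx
  set N : ℕ := 2 ^ (j + 1 + 1) with hN
  have hN₁ : (N : ℝ) = 4 * 2 ^ j := by rw [hN]; push_cast; ring
  have hN₂ : (N : ℝ) ≤ 4 * x := by linarith
  have hN₃ : 2 * x ≤ (N : ℝ) := by rw [hN₁]; rw [pow_succ] at hj₂; linarith
  have hΔ₀ : 0 < Δ := by linarith
  set t := 32 * √(Δ * x) with ht
  have ht₀ : 0 < t := by positivity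
  have h₁ : 2 * √(N * Δ) ≤ t / 8 := by
    have : √(N * Δ) ≤ √(4 * (Δ * x)) := Real.sqrt_le_sqrt (by nlinarith)
    rw [Real.sqrt_mul (x := 4) (by norm_num), show √(4 : ℝ) = 2 by
      rw [show (4 : ℝ) = 2 ^ 2 by norm_num]; exact Real.sqrt_sq (by norm_num)] at this
    linarith
  have htr : ∀ G, ‖noise P G‖ ^ N ≤ (noise P G ^ N).trace := fun G =>
    norm_pow_le_trace (noise_transpose hP G) (j + 1)
  refine (prob_le_expect_div hP (f := fun G => (noise P G ^ N).trace)
    (fun G => le_trans (by positivity) (htr G)) (pow_pos ht₀ N)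
    fun G hG => le_trans (pow_le_pow_left₀ ht₀.le (not_le.1 hG).le N) (htr G)).trans ?_
  have h₂ := expect_trace_noise_pow_le hP (Nat.one_le_two_pow : 1 ≤ N) (hN₂.trans hΔlog) hΔ
  have h₃ : (n : ℝ) * (2 * √(N * Δ)) ^ N ≤ n * (t / 8) ^ N := by gcongr
  have h₄ : (1 / 8 : ℝ) ^ N ≤ 1 / (n : ℝ) ^ 4 := by
    have he : (1 / 8 : ℝ) ≤ Real.exp (-2) := by
      rw [Real.exp_neg, one_div]
      refine inv_anti₀ (Real.exp_pos _) ?_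
      have h := Real.exp_one_lt_d9.le
      calc Real.exp 2 = Real.exp 1 ^ 2 := by rw [← Real.exp_nat_mul]; norm_num
        _ ≤ 2.7182818286 ^ 2 := by gcongr
        _ ≤ 8 := by norm_num
    calc (1 / 8 : ℝ) ^ N ≤ Real.exp (-2) ^ N := by gcongr
      _ = Real.exp (N * -2) := by rw [← Real.exp_nat_mul]
      _ ≤ Real.exp (-(4 * x)) := Real.exp_le_exp.2 (by linarith)
      _ = 1 / (n : ℝ) ^ 4 := by
        rw [Real.exp_neg, one_div, show 4 * x = ((4 : ℕ) : ℝ) * x by norm_num, Real.exp_nat_mul,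
          hx, Real.exp_log hn]
  rw [div_le_iff₀ (pow_pos ht₀ N)]
  calc _ ≤ (n : ℝ) * (t / 8) ^ N := h₂.trans h₃
    _ = n * ((1 / 8) ^ N * t ^ N) := by rw [← mul_pow]; ring_nf
    _ ≤ n * (1 / (n : ℝ) ^ 4 * t ^ N) := by gcongr
    _ = _ := by field_simp

/-! ### Exponential moments of a row of the noise. -/

/-- In `exp y ≤ 1 + y + y²` the linear terms cancel by centring, and the quadratic ones sum to `p (1
- p) z² ≤ p z²`. -/
lemma bernoulli_mgf_le {p z : ℝ} (h₀ : 0 ≤ p) (h₁ : p ≤ 1) (hz : |z| ≤ 1) :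
    p * Real.exp ((1 - p) * z) + (1 - p) * Real.exp ((0 - p) * z) ≤ Real.exp (p * z ^ 2) := by
  have key : ∀ y : ℝ, |y| ≤ 1 → Real.exp y ≤ 1 + y + y ^ 2 := fun y hy => by
    have := (abs_le.1 (Real.abs_exp_sub_one_sub_id_le hy)).2
    linarith
  have hq : 0 ≤ 1 - p := by linarith
  have e₁ := key ((1 - p) * z) (by
    rw [abs_mul, abs_of_nonneg hq]
    exact mul_le_one₀ (by linarith) (abs_nonneg _) hz)
  have e₂ := key ((0 - p) * z) (by
    rw [abs_mul, zero_sub, abs_neg, abs_of_nonneg h₀]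
    exact mul_le_one₀ h₁ (abs_nonneg _) hz)
  have e₃ := Real.add_one_le_exp (p * z ^ 2)
  have e₄ := mul_le_mul_of_nonneg_left e₁ h₀
  have e₅ := mul_le_mul_of_nonneg_left e₂ hq
  have e₆ : 0 ≤ (p * z) ^ 2 := sq_nonneg _
  nlinarith

open Classical in
lemma sum_incident_pairs {n : ℕ} (i : Fin n) (f : Fin n × Fin n → ℝ) :
    ∑ e ∈ vertexPairs n with (e.1 = i ∨ e.2 = i), f e
      = ∑ j ∈ Finset.univ.erase i, f (orderedPair i j) := by
  symm
  refine Finset.sum_bij (fun j _ => orderedPair i j) ?_ ?_ ?_ fun _ _ => rfl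
  · intro j hj
    have hj : j ≠ i := (Finset.mem_erase.1 hj).1
    rw [Finset.mem_filter, mem_vertexPairs]
    rcases lt_or_gt_of_ne hj with h | h
    · simp [orderedPair, h, h.le]
    · simp [orderedPair, h, h.le]
  · intro j _ k _ h
    exact orderedPair_injective i h
  · rintro ⟨u, v⟩ he
    rw [Finset.mem_filter, mem_vertexPairs] at he
    obtain ⟨h, h' | h'⟩ := he
    · simp only at h h'
      subst h'
      exact ⟨v, Finset.mem_erase.2 ⟨h.ne, Finset.mem_univ _⟩, by simp [orderedPair, h.le]⟩
    · simp only at h h'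
      subst h'
      exact ⟨u, Finset.mem_erase.2 ⟨h.ne', Finset.mem_univ _⟩, by simp [orderedPair, h.le]⟩

lemma expect_exp_row_le {n : ℕ} {P : Matrix (Fin n) (Fin n) ℝ} (hP : IsEdgeProb P) (i : Fin n)
    {w : Fin n → ℝ} (hw : ∀ j, |w j| ≤ 1) {c : ℝ} (hc : ∑ j, P i j * w j ^ 2 ≤ c) :
    expect P (fun G => Real.exp (∑ j, noise P G i j * w j)) ≤ Real.exp c := by
  classical
  -- A pair containing `i` carries the weight of its other endpoint; on the remaining pairs the
  -- value does not matter.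
  set z : Fin n × Fin n → ℝ := fun e => if e.1 = i then w e.2 else w e.1 with hz
  have hz₁ : ∀ j ∈ Finset.univ.erase i, z (orderedPair i j) = w j := fun j hj => by
    have hj : j ≠ i := (Finset.mem_erase.1 hj).1
    rcases lt_or_gt_of_ne hj with h | h
    · simp [hz, orderedPair, h.le]
    · simp [hz, orderedPair, h.le, hj]
  have hexp : ∀ G, Real.exp (∑ j, noise P G i j * w j) = ∏ e ∈ vertexPairs n,
      (if e.1 = i ∨ e.2 = i then Real.exp ((adj G e.1 e.2 - P e.1 e.2) * z e) else 1) := fun G => by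
    rw [← Finset.prod_filter, ← Real.exp_sum]
    congr 1
    rw [sum_incident_pairs, ← Finset.add_sum_erase _ _ (Finset.mem_univ i), noise_self, zero_mul,
      zero_add]
    refine Finset.sum_congr rfl fun j hj => ?_
    have hj' : i ≠ j := (Finset.mem_erase.1 hj).1.symm
    rw [hz₁ j hj, prob_orderedPair hP, noise_of_ne _ _ hj']
    rcases le_total i j with h | h
    · simp [orderedPair, h, adj_symm G j i]
    · simp [orderedPair, h]
  simp only [hexp]
  rw [expect_prod P fun e a =>
    if e.1 = i ∨ e.2 = i then Real.exp ((a - P e.1 e.2) * z e) else 1]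
  calc _ ≤ ∏ e ∈ vertexPairs n,
        (if e.1 = i ∨ e.2 = i then Real.exp (P e.1 e.2 * z e ^ 2) else 1) := by
        refine Finset.prod_le_prod (fun e _ => ?_) fun e _ => ?_
        · have h₁ := hP.nonneg e.1 e.2
          have h₂ : 0 ≤ 1 - P e.1 e.2 := by linarith [hP.le_one e.1 e.2]
          split_ifs <;> positivity
        · split_ifs
          · refine bernoulli_mgf_le (hP.nonneg _ _) (hP.le_one _ _) ?_
            simp only [hz]
            split_ifs <;> exact hw _
          · linarith
    _ = Real.exp (∑ j ∈ Finset.univ.erase i, P i j * w j ^ 2) := by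
        rw [← Finset.prod_filter, ← Real.exp_sum, sum_incident_pairs]
        congr 1
        refine Finset.sum_congr rfl fun j hj => ?_
        rw [hz₁ j hj, prob_orderedPair hP]
    _ ≤ Real.exp c := by
        refine Real.exp_le_exp.2 (le_trans ?_ hc)
        exact Finset.sum_le_sum_of_subset_of_nonneg (Finset.erase_subset _ _)
          fun j _ _ => mul_nonneg (hP.nonneg _ _) (sq_nonneg _)

/-- A Bernstein bound for linear statistics of a row of the noise. -/
lemma prob_row_noise_le {n : ℕ} {P : Matrix (Fin n) (Fin n) ℝ} (hP : IsEdgeProb P) (i : Fin n)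
    {w : Fin n → ℝ} (hw : ∀ j, |w j| ≤ 1) {c : ℝ} (hc : ∑ j, P i j * w j ^ 2 ≤ c) (t : ℝ) :
    prob P (fun G => ¬ |∑ j, noise P G i j * w j| ≤ t) ≤ 2 * Real.exp (c - t) := by
  -- Exponential Markov inequality with parameter 1, for `w` and `-w` at once.
  refine (prob_le_expect_div hP (f := fun G => Real.exp (∑ j, noise P G i j * w j)
    + Real.exp (∑ j, noise P G i j * (-w j))) (fun G => by positivity) (Real.exp_pos t)
    fun G hG => ?_).trans ?_
  · have h := Real.exp_le_exp.2 (not_le.1 hG).le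
    simp only [mul_neg, Finset.sum_neg_distrib]
    have h₁ := Real.exp_pos (∑ j, noise P G i j * w j)
    have h₂ := Real.exp_pos (-∑ j, noise P G i j * w j)
    rcases abs_choice (∑ j, noise P G i j * w j) with e | e <;> rw [e] at h <;> linarith
  · have h₁ := expect_exp_row_le hP i hw hc
    have h₂ := expect_exp_row_le hP i (w := fun j => -w j) (by simpa using hw) (by simpa using hc)
    have h₃ : expect P (fun G => Real.exp (∑ j, noise P G i j * w j)
        + Real.exp (∑ j, noise P G i j * (-w j)))
        = expect P (fun G => Real.exp (∑ j, noise P G i j * w j))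
          + expect P (fun G => Real.exp (∑ j, noise P G i j * (-w j))) := by
      simp only [expect, mul_add, Finset.sum_add_distrib]
    rw [h₃, Real.exp_sub, ← mul_div_assoc]
    gcongr
    linarith

/-! ### Perturbation of leading eigenvectors. -/

open Matrix

lemma dotProduct_mulVec_self {m n : ℕ} {U : Matrix (Fin m) (Fin n) ℝ} (hU : U.transpose * U = 1)
    (x : Fin n → ℝ) : U *ᵥ x ⬝ᵥ U *ᵥ x = x ⬝ᵥ x := by
  rw [dotProduct_mulVec, ← mulVec_transpose, mulVec_mulVec, hU, one_mulVec]

lemma dotProduct_self_eq_sum_sq {n : ℕ} (x : Fin n → ℝ) : x ⬝ᵥ x = ∑ i, x i ^ 2 := by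
  simp [dotProduct, sq]

lemma dotProduct_mulVec_le {m n : ℕ} (M : Matrix (Fin m) (Fin n) ℝ) (x : Fin n → ℝ) :
    M *ᵥ x ⬝ᵥ M *ᵥ x ≤ ‖M‖ ^ 2 * (x ⬝ᵥ x) := by
  have h := Matrix.l2_opNorm_mulVec M (WithLp.toLp 2 x)
  rw [EuclideanSpace.norm_eq, EuclideanSpace.norm_eq] at h
  have h' := pow_le_pow_left₀ (Real.sqrt_nonneg _) h 2
  rw [mul_pow, Real.sq_sqrt (by positivity), Real.sq_sqrt (by positivity)] at h'
  rw [dotProduct_self_eq_sum_sq, dotProduct_self_eq_sum_sq]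
  simpa using h'

lemma norm_le_one_of_transpose_mul_self {m n : ℕ} {U : Matrix (Fin m) (Fin n) ℝ}
    (hU : U.transpose * U = 1) : ‖U‖ ≤ 1 := by
  refine l2_opNorm_le_of_mulVec U zero_le_one fun x => ?_
  rw [← dotProduct_self_eq_sum_sq, ← dotProduct_self_eq_sum_sq, dotProduct_mulVec_self hU]
  linarith

lemma norm_transpose_mul_self {m n : ℕ} (U : Matrix (Fin m) (Fin n) ℝ) :
    ‖U.transpose * U‖ = ‖U‖ ^ 2 := by
  rw [← conjTranspose_eq_transpose_of_trivial, l2_opNorm_conjTranspose_mul_self, sq]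

lemma norm_diagonal_le {n : ℕ} {t : Fin n → ℝ} {c : ℝ} (hc : 0 ≤ c) (h : ∀ i, |t i| ≤ c) :
    ‖diagonal t‖ ≤ c := by
  rw [l2_opNorm_diagonal]
  exact (pi_norm_le_iff_of_nonneg hc).2 h

/-- A lower bound, in the spirit of Courant and Fischer, for the leading eigenvalues. -/
lemma le_eigenvalue_of_le_mulVec {n d : ℕ} {B V : Matrix (Fin n) (Fin n) ℝ} {t : Fin n → ℝ}
    (hV : V.transpose * V = 1) (hV' : V * V.transpose = 1) (ht : Antitone t) (ht₀ : ∀ i, 0 ≤ t i)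
    (hB : B = V * diagonal t * V.transpose) {Q : Matrix (Fin n) (Fin d) ℝ}
    (hQ : Q.transpose * Q = 1) {c : ℝ}
    (h : ∀ z : Fin d → ℝ, c ^ 2 * (z ⬝ᵥ z) ≤ (B * Q) *ᵥ z ⬝ᵥ (B * Q) *ᵥ z)
    (k : Fin n) (hk : (k : ℕ) < d) : c ≤ t k := by
  -- As `k < d`, some nonzero `z` has `Q z` orthogonal to the first `k` eigenvectors; on such
  -- vectors `B` stretches by at most `t k`.
  let f : (Fin d → ℝ) →ₗ[ℝ] (Fin k → ℝ) :=
    ((V.transpose * Q).submatrix (Fin.castLE k.2.le) id).mulVecLin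
  have hker : LinearMap.ker f ≠ ⊥ := LinearMap.ker_ne_bot_of_finrank_lt (by simpa using hk)
  obtain ⟨z, hz, hz₀⟩ := (Submodule.ne_bot_iff _).1 hker
  set y := (V.transpose * Q) *ᵥ z with hy
  have hy₀ : ∀ i, i < k → y i = 0 := fun i hi => by
    have := congrFun (LinearMap.mem_ker.1 hz) ⟨i, hi⟩
    simpa [f, hy, mulVec, dotProduct] using this
  have hzz : 0 < z ⬝ᵥ z := by
    rcases (dotProduct_self_eq_sum_sq z ▸ Finset.sum_nonneg fun i _ => sq_nonneg (z i) :
      0 ≤ z ⬝ᵥ z).lt_or_eq with h | h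
    · exact h
    · exact absurd (dotProduct_self_eq_zero.1 h.symm) hz₀
  have hyy : y ⬝ᵥ y = z ⬝ᵥ z := by
    rw [hy, ← mulVec_mulVec, dotProduct_mulVec_self (by simpa using hV'),
      dotProduct_mulVec_self hQ]
  have hBy : (B * Q) *ᵥ z ⬝ᵥ (B * Q) *ᵥ z = ∑ i, (t i * y i) ^ 2 := by
    rw [hB, Matrix.mul_assoc, Matrix.mul_assoc, ← mulVec_mulVec, dotProduct_mulVec_self hV,
      ← mulVec_mulVec, dotProduct_self_eq_sum_sq]
    simp [mulVec_diagonal, hy]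
  have h₁ : ∑ i, (t i * y i) ^ 2 ≤ t k ^ 2 * (z ⬝ᵥ z) := by
    rw [← hyy, dotProduct_self_eq_sum_sq, Finset.mul_sum]
    refine Finset.sum_le_sum fun i _ => ?_
    rcases lt_or_ge i k with hi | hi
    · simp [hy₀ i hi]
    · rw [mul_pow]
      exact mul_le_mul_of_nonneg_right (pow_le_pow_left₀ (ht₀ i) (ht hi) 2) (sq_nonneg _)
  have h₂ := (h z).trans (hBy.le.trans h₁)
  exact (le_abs_self c).trans (abs_le_of_sq_le_sq (le_of_mul_le_mul_right h₂ hzz) (ht₀ k))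

lemma orthogonal_mul_transpose {n : ℕ} {V : Matrix (Fin n) (Fin n) ℝ}
    (hV : V ∈ orthogonalGroup (Fin n) ℝ) : V * V.transpose = 1 := by
  simpa [star_eq_conjTranspose] using (mem_orthogonalGroup_iff (Fin n) ℝ).1 hV

lemma orthogonal_transpose_mul {n : ℕ} {V : Matrix (Fin n) (Fin n) ℝ}
    (hV : V ∈ orthogonalGroup (Fin n) ℝ) : V.transpose * V = 1 := by
  simpa [star_eq_conjTranspose] using (mem_orthogonalGroup_iff' (Fin n) ℝ).1 hV

lemma mem_orthogonal_of_transpose_mul {n : ℕ} {V : Matrix (Fin n) (Fin n) ℝ}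
    (hV : V.transpose * V = 1) : V ∈ orthogonalGroup (Fin n) ℝ := by
  rw [mem_orthogonalGroup_iff']
  simpa [star_eq_conjTranspose] using hV

lemma transpose_mem_orthogonal {n : ℕ} {V : Matrix (Fin n) (Fin n) ℝ}
    (hV : V ∈ orthogonalGroup (Fin n) ℝ) : V.transpose ∈ orthogonalGroup (Fin n) ℝ :=
  mem_orthogonal_of_transpose_mul (by simpa using orthogonal_mul_transpose hV)

lemma submatrix_castLE_transpose_mul {n d : ℕ} (h : d ≤ n) {V : Matrix (Fin n) (Fin n) ℝ}
    (hV : V.transpose * V = 1) :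
    (V.submatrix id (Fin.castLE h)).transpose * V.submatrix id (Fin.castLE h) = 1 := by
  ext i j
  have := congrFun (congrFun hV (Fin.castLE h i)) (Fin.castLE h j)
  simpa [mul_apply, one_apply] using this

lemma eigenvalue_nonneg {n : ℕ} {B V : Matrix (Fin n) (Fin n) ℝ} {t : Fin n → ℝ}
    (hV : V.transpose * V = 1) (hB : B = V * diagonal t * V.transpose) (hpos : B.PosSemidef)
    (i : Fin n) : 0 ≤ t i := by
  have h := (hpos.conjTranspose_mul_mul_same V).diag_nonneg (i := i)
  rw [conjTranspose_eq_transpose_of_trivial] at h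
  have e : V.transpose * B * V = diagonal t := by
    rw [hB]
    calc _ = (V.transpose * V) * diagonal t * (V.transpose * V) := by simp only [Matrix.mul_assoc]
      _ = _ := by rw [hV]; simp
  rw [e] at h
  simpa using h

/-- The eigenvectors of `|A|` for eigenvalues larger than the distance of `A` to the positive
semidefinite matrices are eigenvectors of `A`. -/
lemma mul_eq_of_abs_mul_eq {n d : ℕ} {A P : Matrix (Fin n) (Fin n) ℝ} (hP : P.PosSemidef) {ε : ℝ}
    (hε : ‖A - P‖ ≤ ε) {U : Matrix (Fin n) (Fin d) ℝ} {s : Fin d → ℝ} (hs : ∀ j, ε < s j)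
    (hAU : A * (A * U) = U * diagonal s * diagonal s) : A * U = U * diagonal s := by
  -- From `A² u = s² u`, the vector `(A - s) u` is annihilated by `A + s`. If nonzero, it would be
  -- an eigenvector of `A` for `-s < -ε`, impossible within distance `ε` of a positive semidefinite
  -- matrix.
  set N := A * U - U * diagonal s with hN
  have hAN : A * N = -(N * diagonal s) := by
    rw [hN, Matrix.mul_sub, hAU, Matrix.sub_mul, Matrix.mul_assoc A U]
    abel
  suffices h : N = 0 from sub_eq_zero.1 h
  ext i j
  set w : Fin n → ℝ := fun i => N i j with hw
  have hAw : A *ᵥ w = -(s j) • w := by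
    funext i
    have := congrFun (congrFun hAN i) j
    rw [Matrix.neg_apply, mul_diagonal, mul_apply] at this
    simp only [mulVec, dotProduct, hw, Pi.smul_apply, smul_eq_mul]
    rw [this]
    ring
  have h₁ : w ⬝ᵥ A *ᵥ w = -(s j) * (w ⬝ᵥ w) := by rw [hAw, dotProduct_smul, smul_eq_mul]
  have h₂ : 0 ≤ w ⬝ᵥ P *ᵥ w := by simpa using hP.dotProduct_mulVec_nonneg w
  have hww : 0 ≤ w ⬝ᵥ w := by rw [dotProduct_self_eq_sum_sq]; positivity
  have hε₀ : 0 ≤ ε := (norm_nonneg _).trans hε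
  have h₃ : -(w ⬝ᵥ (A - P) *ᵥ w) ≤ ε * (w ⬝ᵥ w) := by
    have e₁ := dotProduct_mulVec_le (A - P) w
    have e₂ : ‖A - P‖ ^ 2 * (w ⬝ᵥ w) ≤ ε ^ 2 * (w ⬝ᵥ w) := by gcongr
    have e₃ : (w ⬝ᵥ (A - P) *ᵥ w) ^ 2 ≤ (w ⬝ᵥ w) * ((A - P) *ᵥ w ⬝ᵥ (A - P) *ᵥ w) := by
      have := Finset.sum_mul_sq_le_sq_mul_sq Finset.univ w ((A - P) *ᵥ w)
      simpa only [dotProduct, sq] using this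
    have e₄ : (w ⬝ᵥ (A - P) *ᵥ w) ^ 2 ≤ (ε * (w ⬝ᵥ w)) ^ 2 := by
      refine e₃.trans ((mul_le_mul_of_nonneg_left (e₁.trans e₂) hww).trans_eq ?_)
      ring
    exact (neg_le_abs _).trans (abs_le_of_sq_le_sq e₄ (by positivity))
  have h₄ : (s j - ε) * (w ⬝ᵥ w) ≤ 0 := by
    rw [sub_mulVec, dotProduct_sub] at h₃
    linarith
  have h₅ : w ⬝ᵥ w = 0 := by
    have := hs j
    nlinarith
  exact congrFun (dotProduct_self_eq_zero.1 h₅) i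

/-- A matrix with approximately orthonormal columns is close to an orthogonal matrix. -/
lemma exists_orthogonal_near {d : ℕ} (Z : Matrix (Fin d) (Fin d) ℝ) {η : ℝ} (hη : η < 1)
    (hZ : ‖Z.transpose * Z - 1‖ ≤ η) :
    ∃ W ∈ orthogonalGroup (Fin d) ℝ, ‖Z - W‖ ≤ η := by
  have hη₀ : 0 ≤ η := (norm_nonneg _).trans hZ
  have hH : (Z.transpose * Z).IsHermitian := by
    rw [← conjTranspose_eq_transpose_of_trivial]
    exact isHermitian_conjTranspose_mul_self Z
  set V : Matrix (Fin d) (Fin d) ℝ := hH.eigenvectorUnitary.1 with hVdef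
  set e := hH.eigenvalues with he
  have hVo : V ∈ orthogonalGroup (Fin d) ℝ := hH.eigenvectorUnitary.2
  have hV := orthogonal_transpose_mul hVo
  have hV' := orthogonal_mul_transpose hVo
  have hspec : Z.transpose * Z = V * diagonal e * V.transpose := by
    have := hH.spectral_theorem
    rw [Unitary.conjStarAlgAut_apply] at this
    simpa [star_eq_conjTranspose, Function.comp_def] using this
  have hn₁ := norm_le_one_of_transpose_mul_self hV
  have hn₂ : ‖V.transpose‖ ≤ 1 := by rwa [l2_opNorm_transpose]
  have he₁ : ∀ i, |e i - 1| ≤ η := fun i => by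
    have h₁ : V.transpose * (Z.transpose * Z - 1) * V = diagonal fun i => e i - 1 := by
      rw [hspec]
      calc _ = (V.transpose * V) * diagonal e * (V.transpose * V) - V.transpose * V := by
            simp only [Matrix.mul_assoc, Matrix.mul_sub, Matrix.sub_mul, Matrix.one_mul]
        _ = diagonal e - diagonal fun _ => 1 := by rw [hV]; simp
        _ = _ := by rw [diagonal_sub]
    have h₂ : ‖diagonal fun i => e i - 1‖ ≤ η := by
      rw [← h₁]
      calc _ ≤ ‖V.transpose‖ * ‖Z.transpose * Z - 1‖ * ‖V‖ :=
            (norm_mul_le _ _).trans (by gcongr; exact norm_mul_le _ _)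
        _ ≤ 1 * η * 1 := by gcongr
        _ = η := by ring
    simpa using (abs_entry_le_norm (diagonal fun i => e i - 1) i i).trans h₂
  have he₀ : ∀ i, 0 < e i := fun i => by linarith [(abs_le.1 (he₁ i)).1]
  have hsq : ∀ i, 0 < √(e i) := fun i => Real.sqrt_pos.2 (he₀ i)
  -- The orthogonal polar factor `W = Z (ZᵀZ)^{-1/2}`. Then `Z - W = W ((ZᵀZ)^{1/2} - 1)`, and `|√e
  -- - 1| ≤ |e - 1|`.
  set W := Z * (V * diagonal (fun i => (√(e i))⁻¹) * V.transpose) with hW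
  have hWW : W.transpose * W = 1 := by
    rw [hW]
    calc _ = V * diagonal (fun i => (√(e i))⁻¹) * (V.transpose * (Z.transpose * Z) * V)
            * diagonal (fun i => (√(e i))⁻¹) * V.transpose := by
          simp only [transpose_mul, transpose_transpose, diagonal_transpose, Matrix.mul_assoc]
      _ = V * (diagonal (fun i => (√(e i))⁻¹) * diagonal e * diagonal (fun i => (√(e i))⁻¹))
            * V.transpose := by
          have : V.transpose * (Z.transpose * Z) * V = diagonal e := by
            rw [hspec]
            calc _ = (V.transpose * V) * diagonal e * (V.transpose * V) := by
                  simp only [Matrix.mul_assoc]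
              _ = _ := by rw [hV]; simp
          rw [this]
          simp only [Matrix.mul_assoc]
      _ = V * diagonal (fun _ => 1) * V.transpose := by
          rw [diagonal_mul_diagonal, diagonal_mul_diagonal]
          congr 3
          funext i
          have := Real.mul_self_sqrt (he₀ i).le
          have h' := (hsq i).ne'
          field_simp
          linarith
      _ = 1 := by simp [hV']
  refine ⟨W, mem_orthogonal_of_transpose_mul hWW, ?_⟩
  have hZW : Z - W = W * (V * diagonal (fun i => √(e i) - 1) * V.transpose) := by
    have h₁ : W * (V * diagonal (fun i => √(e i)) * V.transpose) = Z := by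
      rw [hW]
      calc _ = Z * (V * (diagonal (fun i => (√(e i))⁻¹) * (V.transpose * V)
              * diagonal (fun i => √(e i))) * V.transpose) := by simp only [Matrix.mul_assoc]
        _ = Z * (V * diagonal (fun _ => 1) * V.transpose) := by
          rw [hV, Matrix.mul_one, diagonal_mul_diagonal]
          congr 4
          funext i
          exact inv_mul_cancel₀ (hsq i).ne'
        _ = Z := by simp [hV']
    have h₂ : diagonal (fun i => √(e i) - 1) = diagonal (fun i => √(e i)) - 1 := by
      rw [← diagonal_one, diagonal_sub]
    rw [h₂, Matrix.mul_sub, Matrix.sub_mul, Matrix.mul_sub, h₁, Matrix.mul_one, hV', Matrix.mul_one]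
  rw [hZW]
  have hd : ‖diagonal fun i => √(e i) - 1‖ ≤ η := norm_diagonal_le hη₀ fun i => by
    refine le_trans ?_ (he₁ i)
    have h₁ : e i - 1 = (√(e i) - 1) * (√(e i) + 1) := by
      have := Real.mul_self_sqrt (he₀ i).le
      linear_combination (-1) * this
    rw [h₁, abs_mul]
    refine le_mul_of_one_le_right (abs_nonneg _) ?_
    rw [abs_of_pos (by linarith [hsq i])]
    linarith [hsq i]
  calc _ ≤ ‖W‖ * (‖V‖ * ‖diagonal fun i => √(e i) - 1‖ * ‖V.transpose‖) :=
        (norm_mul_le _ _).trans (by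
          gcongr
          exact (norm_mul_le _ _).trans (by gcongr; exact norm_mul_le _ _))
    _ ≤ 1 * (1 * η * 1) := by
        gcongr
        exact norm_le_one_of_transpose_mul_self hWW
    _ = η := by ring

lemma abs_inv_sub_inv_le {a b r : ℝ} (hr : 0 < r) (ha : r ≤ a) (hb : r ≤ b) :
    |a⁻¹ - b⁻¹| ≤ |a ^ 2 - b ^ 2| / (2 * r ^ 3) := by
  have ha₀ : 0 < a := hr.trans_le ha
  have hb₀ : 0 < b := hr.trans_le hb
  have h₁ : a⁻¹ - b⁻¹ = -(a ^ 2 - b ^ 2) / (a * b * (a + b)) := by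
    field_simp
    ring
  rw [h₁, abs_div, abs_neg, abs_of_pos (show 0 < a * b * (a + b) by positivity)]
  refine div_le_div_of_nonneg_left (abs_nonneg _) (by positivity) ?_
  calc 2 * r ^ 3 = r * r * (r + r) := by ring
    _ ≤ a * b * (a + b) := by gcongr

/-- If `Z` almost intertwines two diagonal matrices then it almost intertwines their inverse
square roots. -/
lemma norm_commutator_inv_sqrt_le {d : ℕ} {Z : Matrix (Fin d) (Fin d) ℝ} {s p : Fin d → ℝ}
    {r ε : ℝ} (hr : 0 < r) (hs : ∀ j, r ^ 2 ≤ s j) (hp : ∀ j, r ^ 2 ≤ p j)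
    (h : ‖Z * diagonal s - diagonal p * Z‖ ≤ ε) :
    ‖Z * diagonal (fun j => (√(s j))⁻¹) - diagonal (fun j => (√(p j))⁻¹) * Z‖
      ≤ d * (ε / (2 * r ^ 3)) := by
  have hε : 0 ≤ ε := (norm_nonneg _).trans h
  -- Entry `(i, j)` of the hypothesis is `Z i j * (s j - p i)`; passing to inverse square roots
  -- shrinks it by `1 / (2r³)` at least. The Frobenius norm over `d²` entries costs the factor `d`.
  have hent : ∀ i j, (Z * diagonal (fun j => (√(s j))⁻¹)
      - diagonal (fun j => (√(p j))⁻¹) * Z) i j ^ 2 ≤ (ε / (2 * r ^ 3)) ^ 2 := fun i j => by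
    refine sq_le_sq.2 ?_
    rw [abs_of_nonneg (show 0 ≤ ε / (2 * r ^ 3) by positivity)]
    have h₁ := (abs_entry_le_norm _ i j).trans h
    have hsj := (sq_nonneg r).trans (hs j)
    have hpi := (sq_nonneg r).trans (hp i)
    rw [Matrix.sub_apply, mul_diagonal, diagonal_mul] at h₁ ⊢
    have h₂ := abs_inv_sub_inv_le hr (Real.le_sqrt_of_sq_le (hs j)) (Real.le_sqrt_of_sq_le (hp i))
    rw [Real.sq_sqrt hsj, Real.sq_sqrt hpi] at h₂
    calc _ = |Z i j| * |(√(s j))⁻¹ - (√(p i))⁻¹| := by rw [← abs_mul]; ring_nf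
      _ ≤ |Z i j| * (|s j - p i| / (2 * r ^ 3)) := by gcongr
      _ = |Z i j * s j - p i * Z i j| / (2 * r ^ 3) := by
        rw [← mul_div_assoc, ← abs_mul]; ring_nf
      _ ≤ ε / (2 * r ^ 3) := by gcongr
  refine (l2_opNorm_le_frobenius _).trans (Real.sqrt_le_iff.2 ⟨by positivity, ?_⟩)
  calc _ ≤ ∑ _i : Fin d, ∑ _j : Fin d, (ε / (2 * r ^ 3)) ^ 2 :=
        Finset.sum_le_sum fun i _ => Finset.sum_le_sum fun j _ => hent i j
    _ = (d * (ε / (2 * r ^ 3))) ^ 2 := by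
        simp only [Finset.sum_const, Finset.card_univ, Fintype.card_fin, nsmul_eq_mul]
        ring

/-- The leading part of `|A|` is the leading part of `A`, if `A` is a small perturbation of a
positive semidefinite matrix with `d` large eigenvalues. -/
lemma IsASE.exists_eigen {n d : ℕ} {A P : Matrix (Fin n) (Fin n) ℝ} {Y : Matrix (Fin n) (Fin d) ℝ}
    (hY : IsASE A Y) (hA : A.transpose = A) {Q : Matrix (Fin n) (Fin d) ℝ} {p : Fin d → ℝ}
    (hQ : Q.transpose * Q = 1) (hP : P = Q * diagonal p * Q.transpose) {r ε : ℝ} (hr : 0 < r)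
    (hp : ∀ j, 2 * r ^ 2 ≤ p j) (hε : ‖A - P‖ ≤ ε) (hεr : 2 * ε ≤ r ^ 2) :
    ∃ (U : Matrix (Fin n) (Fin d) ℝ) (s : Fin d → ℝ), U.transpose * U = 1 ∧
      (∀ j, 3 / 2 * r ^ 2 ≤ s j) ∧ A * U = U * diagonal s ∧
      Y = A * U * diagonal (fun j => (√(s j))⁻¹) := by
  obtain ⟨B, U, s, ⟨hBpos, hBB⟩, ⟨hdn, V, t, hVo, ht, hB, rfl, rfl⟩, rfl⟩ := hY
  have hV := orthogonal_transpose_mul hVo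
  have hV' := orthogonal_mul_transpose hVo
  have ht₀ := eigenvalue_nonneg hV hB hBpos
  have hr₂ : 0 < r ^ 2 := by positivity
  have hBT : B.transpose = B := by
    rw [← conjTranspose_eq_transpose_of_trivial]
    exact hBpos.isHermitian
  have hPpos : P.PosSemidef := by
    rw [hP, ← conjTranspose_eq_transpose_of_trivial]
    exact (PosSemidef.diagonal fun j => by
      simpa using (by positivity : 0 ≤ 2 * r ^ 2).trans (hp j)).mul_mul_conjTranspose_same Q
  have hnorm : ∀ x : Fin n → ℝ, B *ᵥ x ⬝ᵥ B *ᵥ x = A *ᵥ x ⬝ᵥ A *ᵥ x := fun x => by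
    rw [dotProduct_mulVec, ← mulVec_transpose, mulVec_mulVec, hBT, hBB,
      dotProduct_mulVec (A *ᵥ x), ← mulVec_transpose, mulVec_mulVec]
  -- `B = |A|` and `A` stretch every vector equally. On the range of `Q` the matrix `P` stretches by
  -- at least `2r²` and the perturbation takes away at most `ε ≤ r² / 2`, whence `3/2`.
  have hlow : ∀ z : Fin d → ℝ,
      (3 / 2 * r ^ 2) ^ 2 * (z ⬝ᵥ z) ≤ (B * Q) *ᵥ z ⬝ᵥ (B * Q) *ᵥ z := fun z => by
    rw [← mulVec_mulVec, hnorm]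
    set q := Q *ᵥ z with hq
    have hqz : q ⬝ᵥ q = z ⬝ᵥ z := dotProduct_mulVec_self hQ z
    have hPq : (2 * r ^ 2) ^ 2 * (z ⬝ᵥ z) ≤ P *ᵥ q ⬝ᵥ P *ᵥ q := by
      have : P *ᵥ q = Q *ᵥ (diagonal p *ᵥ z) := by
        rw [hP, hq, mulVec_mulVec, mulVec_mulVec, Matrix.mul_assoc, hQ, Matrix.mul_one]
      rw [this, dotProduct_mulVec_self hQ, dotProduct_self_eq_sum_sq, dotProduct_self_eq_sum_sq,
        Finset.mul_sum]
      refine Finset.sum_le_sum fun j _ => ?_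
      rw [mulVec_diagonal, mul_pow (p j)]
      exact mul_le_mul_of_nonneg_right (pow_le_pow_left₀ (by positivity) (hp j) 2) (sq_nonneg _)
    have hEq := dotProduct_mulVec_le (A - P) q
    rw [hqz] at hEq
    have hzz : 0 ≤ z ⬝ᵥ z := by rw [dotProduct_self_eq_sum_sq]; positivity
    set a := WithLp.toLp 2 (A *ᵥ q)
    set b := WithLp.toLp 2 (P *ᵥ q)
    have na : ‖a‖ ^ 2 = A *ᵥ q ⬝ᵥ A *ᵥ q := by
      rw [EuclideanSpace.real_norm_sq_eq, dotProduct_self_eq_sum_sq]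
    have nb : ‖b‖ ^ 2 = P *ᵥ q ⬝ᵥ P *ᵥ q := by
      rw [EuclideanSpace.real_norm_sq_eq, dotProduct_self_eq_sum_sq]
    have nab : ‖a - b‖ ^ 2 = (A - P) *ᵥ q ⬝ᵥ (A - P) *ᵥ q := by
      rw [EuclideanSpace.real_norm_sq_eq, dotProduct_self_eq_sum_sq, sub_mulVec]
      rfl
    have h₁ : 2 * r ^ 2 * √(z ⬝ᵥ z) ≤ ‖b‖ := by
      refine (le_abs_self _).trans (abs_le_of_sq_le_sq ?_ (norm_nonneg _))
      rw [mul_pow, Real.sq_sqrt hzz, nb]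
      exact hPq
    have h₂ : ‖a - b‖ ≤ ε * √(z ⬝ᵥ z) := by
      have hε₀ : 0 ≤ ε := (norm_nonneg _).trans hε
      refine (le_abs_self _).trans (abs_le_of_sq_le_sq ?_ (by positivity))
      rw [nab, mul_pow, Real.sq_sqrt hzz]
      exact hEq.trans (by gcongr)
    have h₃ : 3 / 2 * r ^ 2 * √(z ⬝ᵥ z) ≤ ‖a‖ := by
      have h := norm_sub_norm_le b a
      rw [norm_sub_rev] at h
      nlinarith [Real.sqrt_nonneg (z ⬝ᵥ z)]
    have h₄ := pow_le_pow_left₀ (by positivity) h₃ 2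
    rwa [mul_pow, Real.sq_sqrt hzz, na] at h₄
  set U := V.submatrix id (Fin.castLE hdn) with hU
  have hs : ∀ j, 3 / 2 * r ^ 2 ≤ (t ∘ Fin.castLE hdn) j := fun j =>
    le_eigenvalue_of_le_mulVec hV hV' ht ht₀ hB hQ hlow (Fin.castLE hdn j) j.2
  set s := t ∘ Fin.castLE hdn with hsdef
  have hBU : B * U = U * diagonal s := by
    have h : B * V = V * diagonal t := by
      rw [hB, Matrix.mul_assoc, hV, Matrix.mul_one]
    ext i j
    have := congrFun (congrFun h i) (Fin.castLE hdn j)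
    rw [mul_diagonal, mul_apply] at this
    rw [mul_diagonal, mul_apply]
    exact this
  have hAU : A * U = U * diagonal s := by
    refine mul_eq_of_abs_mul_eq hPpos hε (fun j => ?_) ?_
    · linarith [hs j]
    · rw [← Matrix.mul_assoc]
      nth_rewrite 1 [← hA]
      rw [← hBB, Matrix.mul_assoc, hBU, ← Matrix.mul_assoc, hBU]
  refine ⟨U, s, submatrix_castLE_transpose_mul hdn hV, hs, hAU, ?_⟩
  rw [hAU, Matrix.mul_assoc, diagonal_mul_diagonal]
  congr 2
  funext j
  have hsj : 0 ≤ s j := le_trans (by positivity) (hs j)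
  rw [← div_eq_mul_inv, Real.div_sqrt]

/-- A deterministic row-wise perturbation bound for adjacency spectral embeddings. -/
lemma IsASE.exists_alignment {n d : ℕ} {A P : Matrix (Fin n) (Fin n) ℝ}
    {Y : Matrix (Fin n) (Fin d) ℝ}
    (hY : IsASE A Y) (hA : A.transpose = A) {Q : Matrix (Fin n) (Fin d) ℝ} {p : Fin d → ℝ}
    (hQ : Q.transpose * Q = 1) (hP : P = Q * diagonal p * Q.transpose) {r ε : ℝ} (hr : 0 < r)
    (hp : ∀ j, 2 * r ^ 2 ≤ p j) (hε : ‖A - P‖ ≤ ε) (hεr : 2 * ε ≤ r ^ 2) :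
    ∃ W ∈ orthogonalGroup (Fin d) ℝ, ∀ i,
      rowNorm (Y * W - P * Q * diagonal fun j => (√(p j))⁻¹) i
        ≤ (d + 4) * (rowNorm A i * ε / r ^ 3) + rowNorm ((A - P) * Q) i / r := by
  obtain ⟨U, s, hU, hs, hAU, hYeq⟩ := hY.exists_eigen hA hQ hP hr hp hε hεr
  have hε₀ : 0 ≤ ε := (norm_nonneg _).trans hε
  have hr₂ : 0 < r ^ 2 := by positivity
  have hs₀ : ∀ j, r ^ 2 ≤ s j := fun j => by linarith [hs j]
  have hp₀ : ∀ j, r ^ 2 ≤ p j := fun j => by linarith [hp j]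
  have hUn := norm_le_one_of_transpose_mul_self hU
  have hQn := norm_le_one_of_transpose_mul_self hQ
  have hQn' : ‖Q.transpose‖ ≤ 1 := by rwa [l2_opNorm_transpose]
  have hinv : ∀ q : Fin d → ℝ, (∀ j, r ^ 2 ≤ q j) → ‖diagonal fun j => (√(q j))⁻¹‖ ≤ r⁻¹ :=
    fun q hq => norm_diagonal_le (by positivity) fun j => by
      have := Real.le_sqrt_of_sq_le (hq j)
      rw [abs_of_nonneg (by positivity)]
      exact inv_anti₀ hr this
  set S := diagonal (fun j => (√(s j))⁻¹) with hS
  set T := diagonal (fun j => (√(p j))⁻¹) with hT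
  have hSn : ‖S‖ ≤ r⁻¹ := hinv s hs₀
  have hTn : ‖T‖ ≤ r⁻¹ := hinv p hp₀
  set ρ := ε / r ^ 2 with hρ
  have hρ₀ : 0 ≤ ρ := by positivity
  have hρ₁ : ρ ≤ 1 / 2 := by
    rw [hρ, div_le_iff₀ hr₂]
    linarith
  set Z := Q.transpose * U with hZ
  -- the component of `U` orthogonal to the range of `Q`
  set R := U - Q * Z with hR
  have hQR : Q.transpose * R = 0 := by
    rw [hR, Matrix.mul_sub, ← Matrix.mul_assoc, hQ, Matrix.one_mul, hZ, sub_self]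
  -- A Davis–Kahan argument: `R diag(s) = (1 - QQᵀ)(A - P) U`, and projecting off the range of `Q`
  -- does not increase norms.
  have hRn : ‖R‖ ≤ ρ := by
    have h₁ : R = ((A - P) * U - Q * (Q.transpose * ((A - P) * U)))
        * diagonal (fun j => (s j)⁻¹) := by
      have hPU : P * U = Q * (diagonal p * Z) := by
        rw [hP, hZ]; simp only [Matrix.mul_assoc]
      have h₂ : (A - P) * U - Q * (Q.transpose * ((A - P) * U)) = R * diagonal s := by
        rw [Matrix.sub_mul, hAU, hPU, Matrix.mul_sub, ← Matrix.mul_assoc Q.transpose Q, hQ,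
          Matrix.one_mul, Matrix.mul_sub, hR, Matrix.sub_mul, hZ]
        simp only [Matrix.mul_assoc]
        abel
      rw [h₂, Matrix.mul_assoc, diagonal_mul_diagonal]
      have : (fun j => s j * (s j)⁻¹) = fun _ => 1 := by
        funext j
        exact mul_inv_cancel₀ (ne_of_gt (hr₂.trans_le (hs₀ j)))
      rw [this, diagonal_one, Matrix.mul_one]
    have h₃ : ‖(A - P) * U - Q * (Q.transpose * ((A - P) * U))‖ ≤ ε := by
      refine l2_opNorm_le_of_mulVec _ hε₀ fun x => ?_
      set y := ((A - P) * U) *ᵥ x with hy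
      have e₁ : ((A - P) * U - Q * (Q.transpose * ((A - P) * U))) *ᵥ x
          = y - Q *ᵥ (Q.transpose *ᵥ y) := by
        rw [sub_mulVec, hy]
        simp only [mulVec_mulVec]
      have e₂ : y ⬝ᵥ Q *ᵥ (Q.transpose *ᵥ y) = Q.transpose *ᵥ y ⬝ᵥ Q.transpose *ᵥ y := by
        rw [dotProduct_mulVec, ← mulVec_transpose]
      have e₃ : Q *ᵥ (Q.transpose *ᵥ y) ⬝ᵥ Q *ᵥ (Q.transpose *ᵥ y)
          = Q.transpose *ᵥ y ⬝ᵥ Q.transpose *ᵥ y := dotProduct_mulVec_self hQ _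
      have e₄ : 0 ≤ Q.transpose *ᵥ y ⬝ᵥ Q.transpose *ᵥ y := by
        rw [dotProduct_self_eq_sum_sq]; positivity
      have e₅ : y ⬝ᵥ y ≤ ε ^ 2 * (x ⬝ᵥ x) := by
        have hxx : 0 ≤ x ⬝ᵥ x := by rw [dotProduct_self_eq_sum_sq]; positivity
        have := dotProduct_mulVec_le (A - P) (U *ᵥ x)
        rw [dotProduct_mulVec_self hU, mulVec_mulVec] at this
        exact this.trans (by gcongr)
      rw [← dotProduct_self_eq_sum_sq, ← dotProduct_self_eq_sum_sq, e₁, sub_dotProduct,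
        dotProduct_sub, dotProduct_sub, e₃, e₂, dotProduct_comm (Q *ᵥ (Q.transpose *ᵥ y)) y, e₂]
      linarith
    have h₄ : ‖diagonal (fun j => (s j)⁻¹)‖ ≤ (r ^ 2)⁻¹ :=
      norm_diagonal_le (by positivity) fun j => by
        have := hr₂.trans_le (hs₀ j)
        rw [abs_of_pos (by positivity)]
        exact inv_anti₀ hr₂ (hs₀ j)
    rw [h₁]
    calc _ ≤ ε * (r ^ 2)⁻¹ := (l2_opNorm_mul _ _).trans (by gcongr)
      _ = ρ := rfl
  -- `U = R + QZ` with orthogonal pieces, so `ZᵀZ - 1 = -RᵀR`: the defect is quadratic in `ρ`.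
  have hZZ : ‖Z.transpose * Z - 1‖ ≤ ρ ^ 2 := by
    have h₁ : U = R + Q * Z := by rw [hR]; abel
    have h₂ : U.transpose * U = R.transpose * R + Z.transpose * Z := by
      have hRQ : R.transpose * Q = 0 := by
        rw [← transpose_transpose Q, ← transpose_mul, hQR, transpose_zero]
      rw [h₁, transpose_add, transpose_mul, Matrix.add_mul, Matrix.mul_add, Matrix.mul_add,
        ← Matrix.mul_assoc R.transpose, hRQ, Matrix.mul_assoc Z.transpose, hQR,
        Matrix.mul_assoc Z.transpose, ← Matrix.mul_assoc Q.transpose, hQ]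
      simp
    have h₃ : Z.transpose * Z - 1 = -(R.transpose * R) := by rw [← hU, h₂]; abel
    rw [h₃, norm_neg, norm_transpose_mul_self]
    gcongr
  obtain ⟨W, hWo, hZW⟩ := exists_orthogonal_near Z (by nlinarith) hZZ
  have hW := orthogonal_transpose_mul hWo
  have hW' := orthogonal_mul_transpose hWo
  have hWn : ‖W.transpose‖ ≤ 1 := norm_le_one_of_transpose_mul_self (by simpa using hW')
  have hUW : ‖U - Q * W‖ ≤ 3 / 2 * ρ := by
    have : U - Q * W = R + Q * (Z - W) := by rw [hR, Matrix.mul_sub]; abel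
    rw [this]
    calc _ ≤ ‖R‖ + ‖Q‖ * ‖Z - W‖ := (norm_add_le _ _).trans (by gcongr; exact l2_opNorm_mul _ _)
      _ ≤ ρ + 1 * ρ ^ 2 := by gcongr
      _ ≤ 3 / 2 * ρ := by nlinarith
  have hZS : ‖Z * diagonal s - diagonal p * Z‖ ≤ ε := by
    have : Z * diagonal s - diagonal p * Z = Q.transpose * (A - P) * U := by
      rw [hZ, Matrix.mul_assoc, ← hAU, Matrix.mul_sub, Matrix.sub_mul, hP]
      simp only [← Matrix.mul_assoc]
      rw [hQ, Matrix.one_mul]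
    rw [this]
    calc _ ≤ ‖Q.transpose‖ * ‖A - P‖ * ‖U‖ :=
          (l2_opNorm_mul _ _).trans (by gcongr; exact l2_opNorm_mul _ _)
      _ ≤ 1 * ε * 1 := by gcongr
      _ = ε := by ring
  -- The part `d / 2` is the commutator bound for `Z`; the part 1 pays for exchanging `Z` with `W`,
  -- at distance at most `ρ / 2`.
  have hcomm : ‖W * S - T * W‖ ≤ (d / 2 + 1) * (ε / r ^ 3) := by
    have h₁ : W * S - T * W = (Z * S - T * Z) - ((Z - W) * S - T * (Z - W)) := by
      rw [Matrix.sub_mul, Matrix.mul_sub]; abel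
    have h₂ := norm_commutator_inv_sqrt_le hr hs₀ hp₀ hZS
    rw [h₁]
    calc _ ≤ d * (ε / (2 * r ^ 3)) + (‖Z - W‖ * ‖S‖ + ‖T‖ * ‖Z - W‖) :=
          (norm_sub_le _ _).trans (add_le_add h₂ ((norm_sub_le _ _).trans
            (add_le_add (norm_mul_le _ _) (norm_mul_le _ _))))
      _ ≤ d * (ε / (2 * r ^ 3)) + (ρ / 2 * r⁻¹ + r⁻¹ * (ρ / 2)) := by
          have : ‖Z - W‖ ≤ ρ / 2 := hZW.trans (by nlinarith)
          gcongr
      _ = _ := by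
          rw [hρ]
          field_simp
          ring
  refine ⟨W.transpose, transpose_mem_orthogonal hWo, fun i => ?_⟩
  -- In the first two terms `A` stands on the left, so only its row norm enters. The third keeps `(A
  -- - P) Q` intact, because its entries concentrate far better than spectral norms show.
  have hdecomp : Y * W.transpose - P * Q * T
      = (A * ((U - Q * W) * S) + A * (Q * (W * S - T * W)) + (A - P) * Q * (T * W))
        * W.transpose := by
    have h₁ : P * Q * T = P * Q * (T * W) * W.transpose := by
      simp only [Matrix.mul_assoc]
      rw [hW', Matrix.mul_one]
    rw [hYeq, h₁, ← Matrix.sub_mul]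
    congr 1
    simp only [Matrix.sub_mul, Matrix.mul_sub, Matrix.mul_assoc]
    abel
  rw [hdecomp]
  have hA₀ := rowNorm_nonneg A i
  have hM₀ := rowNorm_nonneg ((A - P) * Q) i
  have b₁ : rowNorm (A * ((U - Q * W) * S)) i ≤ rowNorm A i * (3 / 2 * ρ * r⁻¹) :=
    (rowNorm_mul_le _ _ _).trans (by gcongr; exact (l2_opNorm_mul _ _).trans (by gcongr))
  have b₂ : rowNorm (A * (Q * (W * S - T * W))) i
      ≤ rowNorm A i * (1 * ((d / 2 + 1) * (ε / r ^ 3))) :=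
    (rowNorm_mul_le _ _ _).trans (by gcongr; exact (l2_opNorm_mul _ _).trans (by gcongr))
  have b₃ : rowNorm ((A - P) * Q * (T * W)) i ≤ rowNorm ((A - P) * Q) i * (r⁻¹ * 1) :=
    (rowNorm_mul_le _ _ _).trans (by
      gcongr
      exact (l2_opNorm_mul _ _).trans
        (by gcongr; exact norm_le_one_of_transpose_mul_self hW))
  have hsum := (rowNorm_add_le (A * ((U - Q * W) * S) + A * (Q * (W * S - T * W)))
    ((A - P) * Q * (T * W)) i).trans (add_le_add_left (rowNorm_add_le _ _ i) _)
  have hfin : rowNorm A i * (3 / 2 * ρ * r⁻¹) = 3 / 2 * (rowNorm A i * ε / r ^ 3) := by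
    rw [hρ]; field_simp
  have hpos : 0 ≤ rowNorm A i * ε / r ^ 3 := by positivity
  calc _ ≤ rowNorm (A * ((U - Q * W) * S) + A * (Q * (W * S - T * W))
          + (A - P) * Q * (T * W)) i * ‖W.transpose‖ := rowNorm_mul_le _ _ _
    _ ≤ rowNorm (A * ((U - Q * W) * S) + A * (Q * (W * S - T * W))
          + (A - P) * Q * (T * W)) i := mul_le_of_le_one_right (rowNorm_nonneg _ _) hWn
    _ ≤ 3 / 2 * (rowNorm A i * ε / r ^ 3) + (d / 2 + 1) * (rowNorm A i * ε / r ^ 3)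
          + rowNorm ((A - P) * Q) i / r := by
        have : rowNorm A i * (1 * ((d / 2 + 1) * (ε / r ^ 3)))
          = (d / 2 + 1) * (rowNorm A i * ε / r ^ 3) := by ring
        have : rowNorm ((A - P) * Q) i * (r⁻¹ * 1) = rowNorm ((A - P) * Q) i / r := by
          rw [mul_one, div_eq_mul_inv]
        linarith
    _ ≤ _ := by
        have hd : (0 : ℝ) ≤ d := Nat.cast_nonneg d
        nlinarith [mul_nonneg hd hpos]

/-- The eigenvalues in a sorted spectral decomposition are unique. -/
lemma eigenvalues₀_eq {n : ℕ} {B V : Matrix (Fin n) (Fin n) ℝ} {t : Fin n → ℝ}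
    (hV : V.transpose * V = 1) (ht : Antitone t) (hB : B = V * diagonal t * V.transpose)
    (hH : B.IsHermitian) (k : ℕ) (hk : k < n) (hk' : k < Fintype.card (Fin n)) :
    hH.eigenvalues₀ ⟨k, hk'⟩ = t ⟨k, hk⟩ := by
  have hroots : B.charpoly.roots = Multiset.map t Finset.univ.val := by
    have : B.charpoly = ∏ i, (Polynomial.X - Polynomial.C (t i)) := by
      rw [hB, charpoly_mul_comm, ← Matrix.mul_assoc, hV, Matrix.one_mul, charpoly_diagonal]
    rw [this, Polynomial.roots_prod]
    · simp
    · simp [Finset.prod_ne_zero_iff, Polynomial.X_sub_C_ne_zero]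
  -- Both lists are the roots of the characteristic polynomial in decreasing order.
  have h₁ : List.ofFn t = List.ofFn hH.eigenvalues₀ := by
    rw [← hH.sort_roots_charpoly_eq_eigenvalues₀, hroots]
    simp_rw [Fin.univ_val_map, Multiset.map_coe, List.map_ofFn, Function.comp_def, RCLike.re_to_real,
      Multiset.coe_sort]
    symm
    apply List.mergeSort_of_pairwise
    simp_rw [decide_eq_true_eq, ← List.sortedGE_iff_pairwise]
    exact ht.sortedGE_ofFn
  have h₂ := List.getElem_of_eq h₁ (i := k) (by simpa using hk)
  simpa using h₂.symm

/-! ### The spectral decomposition of `XXᵀ`. -/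

lemma probMatrix_posSemidef {n : ℕ} {κ : Type*} [Fintype κ] (X : Matrix (Fin n) κ ℝ) :
    (probMatrix X).PosSemidef := by
  rw [probMatrix, ← conjTranspose_eq_transpose_of_trivial]
  exact posSemidef_self_mul_conjTranspose X

/-- `XXᵀ` is positive semidefinite of rank at most `d`, so the sorted eigenvalues beyond the first
`d` vanish and the leading part is all of `XXᵀ`. -/
lemma IsLeadingEigen.eq_of_probMatrix {n d : ℕ} {X U : Matrix (Fin n) (Fin d) ℝ} {s : Fin d → ℝ}
    (h : IsLeadingEigen (probMatrix X) U s) (hd : 1 ≤ d) {c : ℝ}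
    (hgap : c ≤ nthEigenvalue (probMatrix X) d) :
    U.transpose * U = 1 ∧ probMatrix X = U * diagonal s * U.transpose ∧ ∀ j, c ≤ s j := by
  obtain ⟨hdn, V, t, hVo, ht, hB, rfl, rfl⟩ := h
  have hV := orthogonal_transpose_mul hVo
  have ht₀ := eigenvalue_nonneg hV hB (probMatrix_posSemidef X)
  have hH := (probMatrix_posSemidef X).isHermitian
  -- `nthEigenvalue` counts from one; `1 ≤ d ≤ n` keeps the index in range, away from the default
  -- value 0.
  have hd' : d - 1 < n := by omega
  have hcard : d - 1 < Fintype.card (Fin n) := by simpa using hd'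
  rw [nthEigenvalue, dif_pos ⟨hH, hcard⟩, eigenvalues₀_eq hV ht hB hH (d - 1) hd' hcard] at hgap
  have hlead : ∀ i : Fin n, (i : ℕ) < d → c ≤ t i := fun i hi =>
    hgap.trans (ht (show i ≤ ⟨d - 1, hd'⟩ from Fin.le_def.2 (Nat.le_sub_one_of_lt hi)))
  have hrank : (diagonal t).rank ≤ d := by
    have e : V.transpose * probMatrix X * V = diagonal t := by
      rw [hB]
      calc _ = (V.transpose * V) * diagonal t * (V.transpose * V) := by
            simp only [Matrix.mul_assoc]
        _ = _ := by rw [hV]; simp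
    rw [← e]
    exact (rank_mul_le_left _ _).trans ((rank_mul_le_right _ _).trans
      ((rank_mul_le_left X X.transpose).trans X.rank_le_width))
  have htail : ∀ i : Fin n, d ≤ (i : ℕ) → t i = 0 := fun i hi => by
    by_contra hne
    have hpos : 0 < t i := lt_of_le_of_ne (ht₀ i) (Ne.symm hne)
    rw [rank_diagonal, Fintype.card_subtype] at hrank
    have hsub : Finset.Iic i ⊆ Finset.univ.filter fun k => t k ≠ 0 := fun k hk => by
      rw [Finset.mem_filter]
      exact ⟨Finset.mem_univ _, (hpos.trans_le (ht (Finset.mem_Iic.1 hk))).ne'⟩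
    have := Finset.card_le_card hsub
    rw [Fin.card_Iic] at this
    omega
  refine ⟨submatrix_castLE_transpose_mul hdn hV, ?_, fun j => hlead _ j.2⟩
  rw [hB]
  ext a b
  rw [mul_apply, mul_apply]
  symm
  refine Fintype.sum_of_injective (Fin.castLE hdn) (Fin.castLE_injective hdn) _ _ ?_ ?_
  · intro i hi
    rw [mul_diagonal, htail i, mul_zero, zero_mul]
    by_contra hlt
    exact hi ⟨⟨i, not_le.1 hlt⟩, rfl⟩
  · intro j
    rw [mul_diagonal, mul_diagonal]
    rfl

/-! ### Typical graphs. -/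

lemma prob_le_add {n : ℕ} {P : Matrix (Fin n) (Fin n) ℝ} (hP : IsEdgeProb P)
    {s s₁ s₂ : SimpleGraph (Fin n) → Prop} (h : ∀ G, s G → s₁ G ∨ s₂ G) :
    prob P s ≤ prob P s₁ + prob P s₂ := by
  classical
  simp only [prob, Finset.sum_filter]
  rw [← Finset.sum_add_distrib]
  refine Finset.sum_le_sum fun G _ => ?_
  have := edgeWeight_nonneg hP G
  have := h G
  split_ifs <;> first | tauto | linarith

lemma prob_exists_le {n : ℕ} {P : Matrix (Fin n) (Fin n) ℝ} (hP : IsEdgeProb P)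
    {ι : Type*} [Fintype ι] (s : ι → SimpleGraph (Fin n) → Prop) :
    prob P (fun G => ∃ i, s i G) ≤ ∑ i, prob P (s i) := by
  classical
  simp only [prob, Finset.sum_filter]
  rw [Finset.sum_comm]
  refine Finset.sum_le_sum fun G _ => ?_
  have h₀ := edgeWeight_nonneg hP G
  have h₁ : ∀ i ∈ Finset.univ, 0 ≤ (if s i G then edgeWeight P G else 0) := fun i _ => by
    split_ifs <;> first | exact h₀ | exact le_rfl
  split_ifs with h
  · obtain ⟨i, hi⟩ := h
    exact (if_pos hi).symm.le.trans (Finset.single_le_sum h₁ (Finset.mem_univ i))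
  · exact Finset.sum_nonneg h₁

/-- Subadditivity over the finitely many graphs suffices, and only the law of `A` enters. -/
lemma IsRDPG.measureReal_le {n : ℕ} {κ : Type*} [Fintype κ] {Ω : Type*} [MeasurableSpace Ω]
    {μ : Measure Ω} {A : Ω → SimpleGraph (Fin n)} {X : Matrix (Fin n) κ ℝ} (h : IsRDPG μ A X)
    (s : SimpleGraph (Fin n) → Prop) : μ.real {ω | s (A ω)} ≤ prob (probMatrix X) s := by
  classical
  have hP := h.latent.isEdgeProb
  have hset : {ω | s (A ω)} = ⋃ G ∈ Finset.univ.filter s, {ω | A ω = G} := by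
    ext ω
    simp
  have hμ : μ {ω | s (A ω)} ≤ ENNReal.ofReal (prob (probMatrix X) s) := by
    rw [hset, prob, ENNReal.ofReal_sum_of_nonneg fun G _ => edgeWeight_nonneg hP G]
    refine (measure_biUnion_finset_le _ _).trans (le_of_eq ?_)
    refine Finset.sum_congr (by congr) fun G _ => ?_
    rw [h.law, graphProb_eq_edgeWeight]
  refine ENNReal.toReal_le_of_le_ofReal ?_ hμ
  exact Finset.sum_nonneg fun G _ => edgeWeight_nonneg hP G

/-- The noise is small in spectral norm and nearly orthogonal to the columns of `Q`. -/
def IsTypical {n d : ℕ} (P : Matrix (Fin n) (Fin n) ℝ) (Q : Matrix (Fin n) (Fin d) ℝ) (t τ : ℝ)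
    (G : SimpleGraph (Fin n)) : Prop :=
  ‖noise P G‖ ≤ t ∧ ∀ i j, |(noise P G * Q) i j| ≤ τ

/-- Delocalization gives `Q k j ^ 2 ≤ b² / n`, so the variance proxy of each entry of noise times
`Q` is at most `b²`. The threshold `b² + 5 log n` then fails with probability at most `2 / n⁵` for
each of the `n d` entries. -/
lemma prob_not_isTypical_le {n d : ℕ} {P : Matrix (Fin n) (Fin n) ℝ} (hP : IsEdgeProb P) {Δ : ℝ}
    (hlog : 1 ≤ Real.log n) (hΔlog : 4 * Real.log n ≤ Δ) (hΔ : ∀ u, ∑ v, P u v ≤ Δ)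
    {Q : Matrix (Fin n) (Fin d) ℝ} {b : ℝ} (hbn : b ^ 2 ≤ n)
    (hQ : ∀ i j, |Q i j| ≤ b / √n) :
    prob P (fun G => ¬ IsTypical P Q (32 * √(Δ * Real.log n)) (b ^ 2 + 5 * Real.log n) G)
      ≤ 1 / (n : ℝ) ^ 3 + 2 * d / (n : ℝ) ^ 4 := by
  have hn : (0 : ℝ) < n := by
    rcases Nat.eq_zero_or_pos n with rfl | h
    · norm_num at hlog
    · exact_mod_cast h
  have hQ₂ : ∀ i j, Q i j ^ 2 ≤ b ^ 2 / n := fun i j => by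
    rw [← sq_abs, ← Real.sq_sqrt hn.le, ← div_pow]
    exact pow_le_pow_left₀ (abs_nonneg _) (hQ i j) 2
  have hQ₁ : ∀ i j, |Q i j| ≤ 1 := fun i j => by
    rw [← sq_le_one_iff_abs_le_one]
    exact (hQ₂ i j).trans ((div_le_one hn).2 hbn)
  have hrow : ∀ i j, ∑ k, P i k * Q k j ^ 2 ≤ b ^ 2 := fun i j => by
    calc _ ≤ ∑ _k : Fin n, b ^ 2 / n := Finset.sum_le_sum fun k _ => by
          refine (mul_le_of_le_one_left (sq_nonneg _) (hP.le_one i k)).trans (hQ₂ k j)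
      _ = b ^ 2 := by
          rw [Finset.sum_const, Finset.card_univ, Fintype.card_fin, nsmul_eq_mul]
          field_simp
  have h₁ : prob P (fun G => ∃ q : Fin n × Fin d,
      ¬ |(noise P G * Q) q.1 q.2| ≤ b ^ 2 + 5 * Real.log n) ≤ 2 * d / (n : ℝ) ^ 4 := by
    refine (prob_exists_le hP _).trans ?_
    have : ∀ q : Fin n × Fin d, prob P (fun G =>
        ¬ |(noise P G * Q) q.1 q.2| ≤ b ^ 2 + 5 * Real.log n) ≤ 2 / (n : ℝ) ^ 5 := fun q => by
      have h := prob_row_noise_le hP q.1 (w := fun k => Q k q.2) (fun k => hQ₁ k q.2)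
        (hrow q.1 q.2) (b ^ 2 + 5 * Real.log n)
      have e : Real.exp (b ^ 2 - (b ^ 2 + 5 * Real.log n)) = 1 / (n : ℝ) ^ 5 := by
        rw [show b ^ 2 - (b ^ 2 + 5 * Real.log n) = -(((5 : ℕ) : ℝ) * Real.log n) by
          push_cast; ring, Real.exp_neg, Real.exp_nat_mul, Real.exp_log hn, one_div]
      rw [e, mul_one_div] at h
      simpa only [mul_apply] using h
    calc _ ≤ ∑ _q : Fin n × Fin d, 2 / (n : ℝ) ^ 5 := Finset.sum_le_sum fun q _ => this q
      _ = _ := by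
        rw [Finset.sum_const, Finset.card_univ, Fintype.card_prod, Fintype.card_fin,
          Fintype.card_fin, nsmul_eq_mul]
        push_cast
        field_simp
  refine (prob_le_add hP fun G hG => ?_).trans
    (add_le_add (prob_norm_noise_le hP hlog hΔlog hΔ) h₁)
  rw [IsTypical, not_and_or] at hG
  refine hG.imp id fun h => ?_
  push Not at h ⊢
  obtain ⟨i, j, hij⟩ := h
  exact ⟨(i, j), hij⟩

lemma rowNorm_le_of_entry_le {n d : ℕ} {M : Matrix (Fin n) (Fin d) ℝ} {i : Fin n} {c : ℝ}
    (hc : 0 ≤ c) (h : ∀ j, |M i j| ≤ c) : rowNorm M i ≤ d * c := by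
  refine Real.sqrt_le_iff.2 ⟨by positivity, ?_⟩
  calc ∑ j, M i j ^ 2 ≤ ∑ _j : Fin d, c ^ 2 := Finset.sum_le_sum fun j _ => by
        rw [← sq_abs]; exact pow_le_pow_left₀ (abs_nonneg _) (h j) 2
    _ = d * c ^ 2 := by simp
    _ ≤ (d * c) ^ 2 := by
        rw [mul_pow]
        refine mul_le_mul_of_nonneg_right ?_ (sq_nonneg c)
        rcases Nat.eq_zero_or_pos d with rfl | h
        · simp
        · have : (1 : ℝ) ≤ d := by exact_mod_cast h
          nlinarith

lemma norm_le_card_of_support {n : ℕ} {M : Matrix (Fin n) (Fin n) ℝ} {C : Finset (Fin n)}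
    (h₁ : ∀ u v, |M u v| ≤ 1) (h₀ : ∀ u v, ¬ (u ∈ C ∧ v ∈ C) → M u v = 0) : ‖M‖ ≤ C.card := by
  classical
  refine (l2_opNorm_le_frobenius M).trans (Real.sqrt_le_iff.2 ⟨by positivity, ?_⟩)
  calc _ ≤ ∑ u, ∑ v, (if u ∈ C then (if v ∈ C then (1 : ℝ) else 0) else 0) :=
        Finset.sum_le_sum fun u _ => Finset.sum_le_sum fun v _ => by
          split_ifs with hu hv
          · exact (sq_le_one_iff_abs_le_one _).2 (h₁ u v)
          · rw [h₀ u v (by tauto)]; simp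
          · rw [h₀ u v (by tauto)]; simp
    _ = (C.card : ℝ) ^ 2 := by
        have : ∀ u, ∑ v, (if u ∈ C then (if v ∈ C then (1 : ℝ) else 0) else 0)
            = if u ∈ C then (C.card : ℝ) else 0 := fun u => by
          split_ifs <;> simp
        simp only [this]
        simp [sq]

/-- Entries in [0, 1] dominate their squares. Thus a row has norm at most `√Δ`, where the spectral
norm can be of order `Δ`. -/
lemma rowNorm_le_sqrt_sum {n : ℕ} {P : Matrix (Fin n) (Fin n) ℝ} (hP : IsEdgeProb P) {i : Fin n}
    {Δ : ℝ} (hΔ : ∑ v, P i v ≤ Δ) : rowNorm P i ≤ √Δ := by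
  refine Real.sqrt_le_sqrt (le_trans (Finset.sum_le_sum fun j _ => ?_) hΔ)
  nlinarith [hP.nonneg i j, hP.le_one i j]

/-- The embedding of a typical graph whose edge probabilities differ from `P` by a small block is
close, up to rotation, to the scaled eigenvectors of `P`. -/
lemma IsTypical.exists_alignment {n d : ℕ} {P P' : Matrix (Fin n) (Fin n) ℝ}
    (hP' : IsEdgeProb P') {C : Finset (Fin n)}
    (hC₁ : ∀ u v, |(P' - P) u v| ≤ 1) (hC₀ : ∀ u v, ¬ (u ∈ C ∧ v ∈ C) → (P' - P) u v = 0)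
    {Q : Matrix (Fin n) (Fin d) ℝ} {p : Fin d → ℝ} (hQ : Q.transpose * Q = 1)
    (hP : P = Q * diagonal p * Q.transpose) {g D y b : ℝ} (hg : 0 < g) (hD : 1 ≤ D) (hy : 1 ≤ y)
    (hb : 0 ≤ b) (hp : ∀ j, 2 * (g * D) ^ 2 ≤ p j) (hQb : ∀ i j, |Q i j| ≤ b / √n)
    (hΔ : ∀ u, ∑ v, P' u v ≤ 2 * D ^ 2) {G : SimpleGraph (Fin n)}
    (hG : IsTypical P' Q (32 * √(2 * D ^ 2 * y ^ 2)) (b ^ 2 + 5 * y ^ 2) G)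
    (hsmall : 2 * (49 * (D * y) + C.card) ≤ (g * D) ^ 2)
    {Y : Matrix (Fin n) (Fin d) ℝ} (hY : IsASE (adj G) Y) :
    ∃ W ∈ orthogonalGroup (Fin d) ℝ, ∀ i,
      rowNorm (Y * W - P * Q * diagonal fun j => (√(p j))⁻¹) i
        ≤ ((d + 4) * 4000 / g ^ 3 + (d * (b ^ 2 + 5) + 1) / g + d * b / g) *
          (y ^ 4 / D + C.card / (D * √n) + (C.card : ℝ) ^ 2 / D ^ 3) := by
  -- In the application `D = √δ` and `y = √(log n)`.
  obtain ⟨hG₁, hG₂⟩ := hG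
  have hD₀ : 0 < D := by linarith
  have hy₀ : 0 < y := by linarith
  have hDy : 1 ≤ D * y := by nlinarith
  set α : ℝ := (C.card : ℝ) with hα
  have hα₀ : 0 ≤ α := Nat.cast_nonneg _
  have hs2 : √2 ≤ 3 / 2 := Real.sqrt_le_iff.2 ⟨by norm_num, by norm_num⟩
  have hnoise : ‖noise P' G‖ ≤ 48 * (D * y) := by
    have : √(2 * D ^ 2 * y ^ 2) = √2 * (D * y) := by
      rw [mul_assoc, Real.sqrt_mul (by norm_num), ← mul_pow, Real.sqrt_sq (by positivity)]
    rw [this] at hG₁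
    nlinarith
  have hdiag : ‖diagonal fun i => P' i i‖ ≤ 1 := norm_diagonal_le zero_le_one fun i => by
    rw [abs_of_nonneg (hP'.nonneg i i)]
    exact hP'.le_one i i
  have hblock : ‖P' - P‖ ≤ α := norm_le_card_of_support hC₁ hC₀
  have hAP : adj G - P = noise P' G - diagonal (fun i => P' i i) + (P' - P) := by
    rw [noise]; abel
  have hA : adj G = noise P' G - diagonal (fun i => P' i i) + P' := by
    rw [noise]; abel
  have hε : ‖adj G - P‖ ≤ 49 * (D * y) + α := by
    rw [hAP]
    have h₁ := norm_add_le (noise P' G - diagonal (fun i => P' i i)) (P' - P)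
    have h₂ := norm_sub_le (noise P' G) (diagonal (fun i => P' i i))
    linarith
  have hAT : (adj G).transpose = adj G := by
    ext u v
    exact adj_symm G v u
  obtain ⟨W, hW, hrow⟩ := hY.exists_alignment hAT hQ hP (by positivity : 0 < g * D) hp hε hsmall
  refine ⟨W, hW, fun i => (hrow i).trans ?_⟩
  have hAi : rowNorm (adj G) i ≤ 51 * (D * y) := by
    rw [hA]
    have h₁ := rowNorm_add_le (noise P' G - diagonal (fun i => P' i i)) P' i
    have h₂ := (rowNorm_le_norm (noise P' G - diagonal (fun i => P' i i)) i).trans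
      (norm_sub_le (noise P' G) (diagonal (fun i => P' i i)))
    have h₃ := rowNorm_le_sqrt_sum hP' (hΔ i)
    have h₄ : √(2 * D ^ 2) ≤ 3 / 2 * (D * y) := by
      rw [Real.sqrt_mul (by norm_num), Real.sqrt_sq hD₀.le]
      have : D ≤ D * y := by nlinarith
      calc √2 * D ≤ 3 / 2 * D := by gcongr
        _ ≤ _ := by linarith
    linarith
  -- The cross term `D y α` is split into `(D y)²` and `α²`; `y²` is then relaxed to `y⁴`, the `log²
  -- n` of the final bound.
  have hAε : rowNorm (adj G) i * (49 * (D * y) + α) ≤ 4000 * (D ^ 2 * y ^ 4 + α ^ 2) := by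
    have hy₂ : y ^ 2 ≤ y ^ 4 := pow_le_pow_right₀ hy (by norm_num)
    have h₁ : rowNorm (adj G) i * (49 * (D * y) + α) ≤ 51 * (D * y) * (49 * (D * y) + α) := by
      gcongr
    have h₂ : (D * y) ^ 2 ≤ D ^ 2 * y ^ 4 := by rw [mul_pow]; gcongr
    nlinarith [sq_nonneg (D * y - α), sq_nonneg α]
  -- Typicality handles the noise, the diagonal contributes at most 1, and a block row has at most
  -- `α` nonzero entries, each meeting an entry of `Q` of size at most `b / √n`.
  have hM : rowNorm ((adj G - P) * Q) i
      ≤ (d * (b ^ 2 + 5) + 1) * y ^ 4 + d * b * (α / √n) := by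
    have hy₁ : 1 ≤ y ^ 4 := one_le_pow₀ hy
    have hy₂ : y ^ 2 ≤ y ^ 4 := pow_le_pow_right₀ hy (by norm_num)
    have e : (adj G - P) * Q = noise P' G * Q - diagonal (fun i => P' i i) * Q + (P' - P) * Q := by
      rw [hAP, Matrix.add_mul, Matrix.sub_mul]
    have h₁ : rowNorm (noise P' G * Q) i ≤ d * (b ^ 2 + 5 * y ^ 2) :=
      rowNorm_le_of_entry_le (by positivity) (hG₂ i)
    have h₂ : rowNorm (diagonal (fun i => P' i i) * Q) i ≤ 1 := by
      refine (rowNorm_le_norm _ i).trans ((l2_opNorm_mul _ _).trans ?_)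
      exact mul_le_one₀ hdiag (norm_nonneg _) (norm_le_one_of_transpose_mul_self hQ)
    have h₃ : rowNorm ((P' - P) * Q) i ≤ d * (α * (b / √n)) := by
      refine rowNorm_le_of_entry_le (by positivity) fun j => ?_
      rw [mul_apply, ← Finset.sum_subset (Finset.subset_univ C) fun k _ hk => by
        rw [hC₀ i k (by tauto), zero_mul]]
      calc _ ≤ ∑ k ∈ C, |(P' - P) i k * Q k j| := Finset.abs_sum_le_sum_abs _ _
        _ ≤ ∑ _k ∈ C, b / √n := Finset.sum_le_sum fun k _ => by
            rw [abs_mul]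
            exact (mul_le_of_le_one_left (abs_nonneg _) (hC₁ i k)).trans (hQb k j)
        _ = _ := by rw [Finset.sum_const, nsmul_eq_mul]
    have h₄ := rowNorm_add_le (noise P' G * Q - diagonal (fun i => P' i i) * Q) ((P' - P) * Q) i
    have h₅ := rowNorm_sub_le (noise P' G * Q) (diagonal (fun i => P' i i) * Q) i
    have h₆ : (d : ℝ) * (b ^ 2 + 5 * y ^ 2) ≤ d * (b ^ 2 + 5) * y ^ 4 := by
      rw [mul_assoc]
      gcongr
      nlinarith [sq_nonneg b]
    have h₇ : (d : ℝ) * (α * (b / √n)) = d * b * (α / √n) := by ring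
    rw [e]
    linarith
  set T₁ := y ^ 4 / D with hT₁
  set T₂ := α / (D * √n) with hT₂
  set T₃ := α ^ 2 / D ^ 3 with hT₃
  have n₁ : 0 ≤ T₁ := by positivity
  have n₂ : 0 ≤ T₂ := by positivity
  have n₃ : 0 ≤ T₃ := by positivity
  have f₁ : rowNorm (adj G) i * (49 * (D * y) + α) / (g * D) ^ 3 ≤ 4000 / g ^ 3 * (T₁ + T₃) := by
    calc _ ≤ 4000 * (D ^ 2 * y ^ 4 + α ^ 2) / (g * D) ^ 3 := by gcongr
      _ = _ := by
        rw [hT₁, hT₃]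
        field_simp
  have f₂ : rowNorm ((adj G - P) * Q) i / (g * D)
      ≤ (d * (b ^ 2 + 5) + 1) / g * T₁ + d * b / g * T₂ := by
    calc _ ≤ ((d * (b ^ 2 + 5) + 1) * y ^ 4 + d * b * (α / √n)) / (g * D) := by gcongr
      _ = _ := by
        rw [hT₁, hT₂]
        field_simp
  have k₁ : 0 ≤ ((d : ℝ) + 4) * 4000 / g ^ 3 := by positivity
  have k₂ : 0 ≤ ((d : ℝ) * (b ^ 2 + 5) + 1) / g := by positivity
  have k₃ : 0 ≤ (d : ℝ) * b / g := by positivity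
  have f₁' := mul_le_mul_of_nonneg_left f₁ (show (0 : ℝ) ≤ d + 4 by positivity)
  rw [show ((d : ℝ) + 4) * (4000 / g ^ 3 * (T₁ + T₃))
    = (d + 4) * 4000 / g ^ 3 * (T₁ + T₃) by ring] at f₁'
  nlinarith [mul_nonneg k₁ n₂, mul_nonneg k₂ n₂, mul_nonneg k₂ n₃, mul_nonneg k₃ n₁,
    mul_nonneg k₃ n₃]

/-! ### The planted block. -/

lemma probMatrix_augment {n d : ℕ} (X : Matrix (Fin n) (Fin d) ℝ) (C : Finset (Fin n))
    (u v : Fin n) : probMatrix (augment X C) u v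
      = probMatrix X u v + cliqueColumn X C u * cliqueColumn X C v := by
  simp [probMatrix, augment, mul_apply, Fintype.sum_sum_type]

lemma cliqueColumn_nonneg {n d : ℕ} (X : Matrix (Fin n) (Fin d) ℝ) (C : Finset (Fin n))
    (u : Fin n) : 0 ≤ cliqueColumn X C u := by
  rw [cliqueColumn]
  split_ifs <;> positivity

lemma cliqueColumn_le_one {n d : ℕ} (X : Matrix (Fin n) (Fin d) ℝ) (C : Finset (Fin n))
    (u : Fin n) : cliqueColumn X C u ≤ 1 := by
  rw [cliqueColumn]
  split_ifs
  · refine Real.sqrt_le_one.2 ?_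
    have : 0 ≤ ∑ j, X u j ^ 2 := by positivity
    linarith
  · exact zero_le_one

lemma cliqueColumn_of_notMem {n d : ℕ} (X : Matrix (Fin n) (Fin d) ℝ) {C : Finset (Fin n)}
    {u : Fin n} (h : u ∉ C) : cliqueColumn X C u = 0 := if_neg h

lemma sum_le_maxDegree {n : ℕ} (P : Matrix (Fin n) (Fin n) ℝ) (u : Fin n) :
    ∑ v, P u v ≤ maxDegree P :=
  le_ciSup (f := fun i => ∑ j, P i j) (Set.finite_range _).bddAbove u

lemma sum_probMatrix_augment_le {n d : ℕ} (X : Matrix (Fin n) (Fin d) ℝ) (C : Finset (Fin n))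
    (u : Fin n) :
    ∑ v, probMatrix (augment X C) u v ≤ maxDegree (probMatrix X) + C.card := by
  classical
  simp only [probMatrix_augment, Finset.sum_add_distrib]
  refine add_le_add (sum_le_maxDegree _ u) ?_
  calc _ ≤ ∑ v, (if v ∈ C then (1 : ℝ) else 0) := Finset.sum_le_sum fun v _ => by
        split_ifs with hv
        · exact mul_le_one₀ (cliqueColumn_le_one X C u) (cliqueColumn_nonneg X C v)
            (cliqueColumn_le_one X C v)
        · rw [cliqueColumn_of_notMem X hv, mul_zero]
    _ = C.card := by simp

/-- Delocalization is assumed only after a rotation. Rotations preserve row norms, so it passes to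
`U` with the loss of a factor `d`. -/
lemma abs_entry_le_of_rotation {n d : ℕ} {U : Matrix (Fin n) (Fin d) ℝ}
    {W : Matrix (Fin d) (Fin d) ℝ} (hW : W ∈ orthogonalGroup (Fin d) ℝ) {c : ℝ} (hc : 0 ≤ c)
    (h : ∀ i j, |(U * W) i j| ≤ c) (i : Fin n) (j : Fin d) : |U i j| ≤ d * c := by
  have h₁ : |U i j| ≤ rowNorm U i := by
    refine Real.le_sqrt_of_sq_le ?_
    rw [sq_abs]
    exact Finset.single_le_sum (f := fun j => U i j ^ 2) (fun _ _ => sq_nonneg _)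
      (Finset.mem_univ j)
  have h₂ : U = U * W * W.transpose := by
    rw [Matrix.mul_assoc, orthogonal_mul_transpose hW, Matrix.mul_one]
  have h₃ : ‖W.transpose‖ ≤ 1 :=
    norm_le_one_of_transpose_mul_self (by simpa using orthogonal_mul_transpose hW)
  calc |U i j| ≤ rowNorm (U * W * W.transpose) i := by rwa [← h₂]
    _ ≤ rowNorm (U * W) i * ‖W.transpose‖ := rowNorm_mul_le _ _ _
    _ ≤ rowNorm (U * W) i := mul_le_of_le_one_right (rowNorm_nonneg _ _) h₃
    _ ≤ d * c := rowNorm_le_of_entry_le hc (h i)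

end

end RDPG

/-! ### Comparison of the two embeddings. -/

namespace RDPG

open scoped Matrix.Norms.L2Operator
open Matrix

/-- The comparison of the two embeddings when both graphs are typical. -/
lemma exists_rotations_of_isTypical {n d : ℕ} {X Q : Matrix (Fin n) (Fin d) ℝ}
    {C : Finset (Fin n)} (hX : IsLatentPosition X) (hXC : IsLatentPosition (augment X C))
    {p : Fin d → ℝ} (hQ : Q.transpose * Q = 1)
    (hP : probMatrix X = Q * diagonal p * Q.transpose) {g D y b : ℝ} (hg : 0 < g) (hD : 1 ≤ D)
    (hy : 1 ≤ y) (hb : 0 ≤ b) (hp : ∀ j, 2 * (g * D) ^ 2 ≤ p j)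
    (hQb : ∀ i j, |Q i j| ≤ b / √n) (hδ : maxDegree (probMatrix X) = D ^ 2)
    (hCD : (C.card : ℝ) ≤ D ^ 2) (hsmall : 2 * (49 * (D * y) + C.card) ≤ (g * D) ^ 2)
    {G Gc : SimpleGraph (Fin n)}
    (hG : IsTypical (probMatrix X) Q (32 * √(2 * D ^ 2 * y ^ 2)) (b ^ 2 + 5 * y ^ 2) G)
    (hGc : IsTypical (probMatrix (augment X C)) Q (32 * √(2 * D ^ 2 * y ^ 2))
      (b ^ 2 + 5 * y ^ 2) Gc)
    {Y Yc : Matrix (Fin n) (Fin d) ℝ} (hY : IsASE (adj G) Y) (hYc : IsASE (adj Gc) Yc) :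
    ∃ W₁ ∈ orthogonalGroup (Fin d) ℝ, ∃ W₂ ∈ orthogonalGroup (Fin d) ℝ,
      twoToInfNorm (Yc * W₁ - Y * W₂) ≤
        2 * ((d + 4) * 4000 / g ^ 3 + (d * (b ^ 2 + 5) + 1) / g + d * b / g) *
          (y ^ 4 / D + C.card / (D * √n) + (C.card : ℝ) ^ 2 / D ^ 3) := by
  have hblock : ∀ u v, (probMatrix (augment X C) - probMatrix X) u v
      = cliqueColumn X C u * cliqueColumn X C v := fun u v => by
    rw [Matrix.sub_apply, probMatrix_augment, add_sub_cancel_left]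
  obtain ⟨W₁, hW₁, h₁⟩ := hGc.exists_alignment hXC.isEdgeProb (C := C) (P := probMatrix X)
    (fun u v => by
      rw [hblock, abs_of_nonneg (mul_nonneg (cliqueColumn_nonneg X C u) (cliqueColumn_nonneg X C v))]
      exact mul_le_one₀ (cliqueColumn_le_one X C u) (cliqueColumn_nonneg X C v)
        (cliqueColumn_le_one X C v))
    (fun u v huv => by
      rw [hblock]
      by_cases hu : u ∈ C
      · rw [cliqueColumn_of_notMem X fun hv => huv ⟨hu, hv⟩, mul_zero]
      · rw [cliqueColumn_of_notMem X hu, zero_mul])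
    hQ hP hg hD hy hb hp hQb
    (fun u => (sum_probMatrix_augment_le X C u).trans (by rw [hδ]; linarith)) hsmall hYc
  -- The original graph is the case of an empty block, with the same reference matrix.
  obtain ⟨W₂, hW₂, h₂⟩ := hG.exists_alignment hX.isEdgeProb (C := ∅) (P := probMatrix X)
    (fun u v => by simp) (fun u v _ => by simp) hQ hP hg hD hy hb hp hQb
    (fun u => (sum_le_maxDegree _ u).trans (by rw [hδ]; linarith [sq_nonneg D]))
    (le_trans (by simp) hsmall) hY
  refine ⟨W₁, hW₁, W₂, hW₂, ?_⟩
  set k := ((d : ℝ) + 4) * 4000 / g ^ 3 + (d * (b ^ 2 + 5) + 1) / g + d * b / g with hk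
  have hk₀ : 0 ≤ k := by positivity
  have hD₀ : 0 < D := by linarith
  set B := probMatrix X * Q * diagonal fun j => (√(p j))⁻¹ with hB
  refine Real.iSup_le (fun i => ?_) (by positivity)
  have h := rowNorm_sub_le (Yc * W₁ - B) (Y * W₂ - B) i
  rw [sub_sub_sub_cancel_right] at h
  have h₃ : k * (y ^ 4 / D + ((∅ : Finset (Fin n)).card : ℝ) / (D * √n)
      + ((∅ : Finset (Fin n)).card : ℝ) ^ 2 / D ^ 3)
      ≤ k * (y ^ 4 / D + C.card / (D * √n) + (C.card : ℝ) ^ 2 / D ^ 3) := by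
    refine mul_le_mul_of_nonneg_left ?_ hk₀
    have e₁ : 0 ≤ (C.card : ℝ) / (D * √n) := by positivity
    have e₂ : 0 ≤ (C.card : ℝ) ^ 2 / D ^ 3 := by positivity
    simp only [Finset.card_empty, Nat.cast_zero, zero_div, ne_eq, OfNat.ofNat_ne_zero,
      not_false_eq_true, zero_pow, add_zero]
    linarith
  exact h.trans (by linarith [h₁ i, h₂ i])

lemma two_mul_tail_le {c x : ℝ} (hc : 0 ≤ c) (hx : 4 + 4 * c ≤ x) :
    2 * (1 / x ^ 3 + 2 * c / x ^ 4) ≤ 1 / x ^ 2 := by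
  have hx₀ : 0 < x := by linarith
  have e : 1 / x ^ 2 - 2 * (1 / x ^ 3 + 2 * c / x ^ 4) = (x * (x - 2) - 4 * c) / x ^ 4 := by
    field_simp
    ring
  have h₁ : x * 1 ≤ x * (x - 2) := by gcongr; linarith
  have h₂ : 0 ≤ (x * (x - 2) - 4 * c) / x ^ 4 := div_nonneg (by linarith) (by positivity)
  linarith

end RDPG

set_option maxHeartbeats 1000000 in
theorem theorem1
    (d : ℕ) (hd : 1 ≤ d)
    -- latent positions and vertex sets of the pseudo-cliques
    (X : ∀ n : ℕ, Matrix (Fin n) (Fin d) ℝ)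
    (C : ∀ n : ℕ, Finset (Fin n))
    -- the random graphs, with an arbitrary joint distribution for each `n`
    {Ω : ℕ → Type*} [∀ n, MeasurableSpace (Ω n)]
    (μ : ∀ n, Measure (Ω n)) [∀ n, IsProbabilityMeasure (μ n)]
    (A : ∀ n, Ω n → SimpleGraph (Fin n))
    (Ac : ∀ n, Ω n → SimpleGraph (Fin n))
    (hA : ∀ n, 2 ≤ n → IsRDPG (μ n) (A n) (X n))
    (hAc : ∀ n, 2 ≤ n → IsRDPG (μ n) (Ac n) (augment (X n) (C n)))
    -- (i) rank
    (hrank : ∀ᶠ n in atTop, (X n).rank = d)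
    -- (ii) growth of the maximal expected degree
    (hdeg : ∃ a : ℝ, 0 < a ∧ ∀ᶠ n : ℕ in atTop,
      Real.log n ^ (4 + a) ≤ maxDegree (probMatrix (X n)))
    -- (iii) spectral gap
    (hgap : ∃ c₀ : ℝ, 0 < c₀ ∧ ∀ᶠ n : ℕ in atTop,
      c₀ ≤ nthEigenvalue (probMatrix (X n)) d / maxDegree (probMatrix (X n)))
    -- (iv) delocalization of the leading eigenvectors, up to rotation
    (hdeloc : ∃ (c₁ c₂ : ℝ) (U : ∀ n : ℕ, Matrix (Fin n) (Fin d) ℝ)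
        (W : ℕ → Matrix (Fin d) (Fin d) ℝ), 0 < c₁ ∧ 0 < c₂ ∧
      ∀ᶠ n : ℕ in atTop,
        (∃ s, IsLeadingEigen (probMatrix (X n)) (U n) s) ∧
        W n ∈ Matrix.orthogonalGroup (Fin d) ℝ ∧
        ∀ i j, c₁ / √n ≤ |(U n * W n) i j| ∧ |(U n * W n) i j| ≤ c₂ / √n)
    -- size of the pseudo-clique
    (hα : (fun n : ℕ => ((C n).card : ℝ)) =o[atTop]
      fun n : ℕ => maxDegree (probMatrix (X n)) ^ (3 / 4 : ℝ)) :
    ∃ K : ℝ, 0 < K ∧ ∀ᶠ n : ℕ in atTop,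
      1 - 1 / (n : ℝ) ^ 2 ≤ (μ n).real {ω |
        ∀ Yc Y : Matrix (Fin n) (Fin d) ℝ,
          IsASE (adj (Ac n ω)) Yc → IsASE (adj (A n ω)) Y →
          ∃ W₁ ∈ Matrix.orthogonalGroup (Fin d) ℝ, ∃ W₂ ∈ Matrix.orthogonalGroup (Fin d) ℝ,
            twoToInfNorm (Yc * W₁ - Y * W₂) ≤
              K * (Real.log n ^ 2 / maxDegree (probMatrix (X n)) ^ (1 / 2 : ℝ)
                + (C n).card / (maxDegree (probMatrix (X n)) ^ (1 / 2 : ℝ) * √n)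
                + ((C n).card : ℝ) ^ 2 / maxDegree (probMatrix (X n)) ^ (3 / 2 : ℝ))} := by
  obtain ⟨a, ha, hdeg⟩ := hdeg
  obtain ⟨c₀, hc₀, hgap⟩ := hgap
  obtain ⟨c₁, c₂, U, W, hc₁, hc₂, hdeloc⟩ := hdeloc
  -- Chosen so that `2 (g D)² = c₀ δ`, the lower bound for `λ_d`.
  set g := √(c₀ / 2) with hgdef
  have hg : 0 < g := Real.sqrt_pos.2 (by positivity)
  have hg₂ : g ^ 2 = c₀ / 2 := Real.sq_sqrt (by positivity)
  set b : ℝ := d * c₂ with hbdef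
  have hb : 0 ≤ b := by positivity
  refine ⟨2 * ((d + 4) * 4000 / g ^ 3 + (d * (b ^ 2 + 5) + 1) / g + d * b / g), by positivity, ?_⟩
  have hlog := Real.tendsto_log_atTop.comp (tendsto_natCast_atTop_atTop (R := ℝ))
  -- The bound 1 keeps the augmented row sums below `2δ`; the bound `g² / 4` lets the block use at
  -- most half of the room in `hsmall`.
  have hα' := (hα.bound (show (0 : ℝ) < min 1 (g ^ 2 / 4) by positivity))
  filter_upwards [hdeg, hgap, hdeloc, hα', hlog.eventually_ge_atTop 4,
    hlog.eventually_ge_atTop (196 / g ^ 2), eventually_ge_atTop (4 + 4 * d),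
    (tendsto_natCast_atTop_atTop (R := ℝ)).eventually_ge_atTop (b ^ 2)]
    with n hdeg hgap hdeloc hα hx₄ hxg hnd hbn
  simp only [Function.comp_apply] at hx₄ hxg
  obtain ⟨⟨s, hs⟩, hW, hent⟩ := hdeloc
  have hn₂ : 2 ≤ n := by omega
  have hn₀ : (0 : ℝ) < n := by exact_mod_cast (show 0 < n by omega)
  set δ := maxDegree (probMatrix (X n)) with hδ
  set x := Real.log n with hx
  have hδx : x ^ 4 ≤ δ := by
    refine le_trans ?_ hdeg
    rw [← Real.rpow_natCast]
    exact Real.rpow_le_rpow_of_exponent_le (by linarith) (by push_cast; linarith)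
  have hx₀ : 0 < x := by linarith
  have hδ₁ : 1 ≤ δ := (one_le_pow₀ (by linarith)).trans hδx
  set D := √δ with hDdef
  set y := √x with hydef
  have hD₂ : D ^ 2 = δ := Real.sq_sqrt (by linarith)
  have hy₂ : y ^ 2 = x := Real.sq_sqrt hx₀.le
  have hD : 1 ≤ D := Real.one_le_sqrt.2 hδ₁
  have hy : 1 ≤ y := Real.one_le_sqrt.2 (by linarith)
  have hDx : x ^ 2 ≤ D := Real.le_sqrt_of_sq_le (by rw [← pow_mul]; exact hδx)
  have hα₁ : ((C n).card : ℝ) ≤ min 1 (g ^ 2 / 4) * δ := by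
    rw [Real.norm_of_nonneg (by positivity), Real.norm_of_nonneg (by positivity)] at hα
    refine hα.trans (mul_le_mul_of_nonneg_left ?_ (by positivity))
    calc δ ^ (3 / 4 : ℝ) ≤ δ ^ (1 : ℝ) :=
          Real.rpow_le_rpow_of_exponent_le hδ₁ (by norm_num)
      _ = δ := Real.rpow_one δ
  have hα₂ : ((C n).card : ℝ) ≤ D ^ 2 := by
    rw [hD₂]
    exact hα₁.trans (mul_le_of_le_one_left (by linarith) (min_le_left _ _))
  have hα₃ : ((C n).card : ℝ) ≤ g ^ 2 / 4 * D ^ 2 := by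
    rw [hD₂]
    exact hα₁.trans (mul_le_mul_of_nonneg_right (min_le_right _ _) (by linarith))
  -- The noise gets the other half: `y ≤ x`, `x² ≤ D` by the growth of `δ`, and `x ≥ 196 / g²`.
  have hsmall : 2 * (49 * (D * y) + (C n).card) ≤ (g * D) ^ 2 := by
    rw [div_le_iff₀ (by positivity)] at hxg
    have hyx : y ≤ x := by nlinarith
    have h₁ : 98 * (D * y) ≤ g ^ 2 / 2 * D ^ 2 := by
      have e₁ : 98 ≤ g ^ 2 / 2 * x := by linarith
      calc 98 * (D * y) ≤ g ^ 2 / 2 * x * (D * x) := by gcongr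
        _ = g ^ 2 / 2 * (x ^ 2 * D) := by ring
        _ ≤ g ^ 2 / 2 * (D * D) := by gcongr
        _ = _ := by ring
    rw [mul_pow]
    linarith
  have hgap' : 2 * (g * D) ^ 2 ≤ nthEigenvalue (probMatrix (X n)) d := by
    rw [le_div_iff₀ (by linarith)] at hgap
    rw [mul_pow, hg₂, hD₂]
    linarith
  obtain ⟨hQ, hPeq, hp⟩ := hs.eq_of_probMatrix hd hgap'
  have hQb : ∀ i j, |U n i j| ≤ b / √n := fun i j => by
    have := abs_entry_le_of_rotation hW (by positivity) (fun i j => (hent i j).2) i j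
    rwa [← mul_div_assoc] at this
  have hRA := hA n hn₂
  have hRAc := hAc n hn₂
  have hx4δ : 4 * x ≤ 2 * D ^ 2 := by
    rw [hD₂]
    nlinarith [pow_le_pow_left₀ (by norm_num : (0 : ℝ) ≤ 4) hx₄ 3]
  set good : SimpleGraph (Fin n) → Prop :=
    IsTypical (probMatrix (X n)) (U n) (32 * √(2 * D ^ 2 * y ^ 2)) (b ^ 2 + 5 * y ^ 2) with hgood
  set goodc : SimpleGraph (Fin n) → Prop :=
    IsTypical (probMatrix (augment (X n) (C n))) (U n) (32 * √(2 * D ^ 2 * y ^ 2))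
      (b ^ 2 + 5 * y ^ 2) with hgoodc
  have hbad : (μ n).real {ω | ¬ good (A n ω)} ≤ 1 / (n : ℝ) ^ 3 + 2 * d / (n : ℝ) ^ 4 := by
    refine (hRA.measureReal_le fun G => ¬ good G).trans ?_
    rw [hgood, hy₂]
    exact prob_not_isTypical_le hRA.latent.isEdgeProb (by linarith) hx4δ
      (fun u => (sum_le_maxDegree _ u).trans (by linarith)) hbn hQb
  have hbadc : (μ n).real {ω | ¬ goodc (Ac n ω)} ≤ 1 / (n : ℝ) ^ 3 + 2 * d / (n : ℝ) ^ 4 := by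
    refine (hRAc.measureReal_le fun G => ¬ goodc G).trans ?_
    rw [hgoodc, hy₂]
    exact prob_not_isTypical_le hRAc.latent.isEdgeProb (by linarith) hx4δ
      (fun u => (sum_probMatrix_augment_le _ _ u).trans (by linarith)) hbn hQb
  have hn₄ : (4 : ℝ) + 4 * d ≤ n := by exact_mod_cast hnd
  have htotal : 2 * (1 / (n : ℝ) ^ 3 + 2 * d / (n : ℝ) ^ 4) ≤ 1 / (n : ℝ) ^ 2 := two_mul_tail_le (Nat.cast_nonneg d) hn₄
  set E : Set (Ω n) := {ω | ∀ Yc Y : Matrix (Fin n) (Fin d) ℝ,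
    IsASE (adj (Ac n ω)) Yc → IsASE (adj (A n ω)) Y →
    ∃ W₁ ∈ Matrix.orthogonalGroup (Fin d) ℝ, ∃ W₂ ∈ Matrix.orthogonalGroup (Fin d) ℝ,
      twoToInfNorm (Yc * W₁ - Y * W₂) ≤
        2 * ((d + 4) * 4000 / g ^ 3 + (d * (b ^ 2 + 5) + 1) / g + d * b / g) *
          (x ^ 2 / δ ^ (1 / 2 : ℝ) + (C n).card / (δ ^ (1 / 2 : ℝ) * √n)
            + ((C n).card : ℝ) ^ 2 / δ ^ (3 / 2 : ℝ))} with hE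
  -- Covering the whole space and using subadditivity avoids any measurability claim about `E`.
  have hcover : (Set.univ : Set (Ω n))
      ⊆ E ∪ ({ω | ¬ good (A n ω)} ∪ {ω | ¬ goodc (Ac n ω)}) := fun ω _ => by
    by_cases h₁ : good (A n ω)
    · by_cases h₂ : goodc (Ac n ω)
      · left
        intro Yc Y hYc hY
        have hδD : δ ^ (1 / 2 : ℝ) = D := (Real.sqrt_eq_rpow δ).symm
        have hδD₃ : δ ^ (3 / 2 : ℝ) = D ^ 3 := by
          rw [show (3 / 2 : ℝ) = 1 / 2 * (3 : ℕ) by norm_num, Real.rpow_mul (by linarith),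
            Real.rpow_natCast, hδD]
        have hy₄ : x ^ 2 = y ^ 4 := by rw [← hy₂]; ring
        rw [hδD, hδD₃, hy₄]
        exact exists_rotations_of_isTypical hRA.latent hRAc.latent hQ hPeq hg hD hy hb hp hQb
          hD₂.symm hα₂ hsmall h₁ h₂ hY hYc
      · exact Or.inr (Or.inr h₂)
    · exact Or.inr (Or.inl h₁)
  have hone : 1 ≤ (μ n).real E + ((μ n).real {ω | ¬ good (A n ω)}
      + (μ n).real {ω | ¬ goodc (Ac n ω)}) := by
    rw [← probReal_univ (μ := μ n)]
    exact (measureReal_mono hcover).trans ((measureReal_union_le _ _).trans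
      (add_le_add_right (measureReal_union_le _ _) _))
  linarith
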